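/- **Setting.** Let $\mathcal V$ be a unitary vertex operator algebra (with vacuum $\mathbf 1$, conformal vector $\omega$, Virasoro operators $L_n$, and antilinear automorphism $\phi$), and let $A,B,C$ be unitary $\mathcal V$-modules, i.e. modules with a positive definite Hermitian form satisfying $\langle x,\mathsf Y(e^{zL_1}(-z^{-2})^{L_0}v,z^{-1})y\rangle=\langle \mathsf Y(\phi(v),z)x,y\rangle$. Each module is graded by levels, $A=\bigoplus_{n\ge 0}A_n$, and is generated by its top level $A_0$ (as is every direct sum of irreducible modules with non-zero top levels, graded by $A_n=\bigoplus_i A[i]_n$). A mode $v_k$ with $v$ of weight $d$ maps $A_n$ into $A_{n+d-k-1}$, and there is a finite set $I_A$ such that $A_n=\bigoplus_{\alpha\in I_A}A_{n,\alpha}$, where $L_0$ acts on $A_{n,\alpha}$ as $\alpha+n$. Norms on modules come from the Hermitian forms, and $\widehat B,\widehat C$ denote the Hilbert space completions of $B$ and $C$. Let $\mathcal Y$ be an intertwiner of type $\binom{C}{A\;B}$ and $I=\{\alpha+\beta-\gamma:\alpha\in I_A,\beta\in I_B,\gamma\in I_C\}$. For $a\in A_n$ write $\mathcal Y(a,z)=\sum_{\tau\in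 I,\,m\in\mathbb Z}\mathsf y(a)_{\tau,m}z^{-m-\tau-n}$ with $\mathsf y(a)_{\tau,m}B_k\subset C_{k-m}$ for all $k$, and for $N>0$ let $\mathcal Y^{[N]}(a,z)$ be the part of this sum with $|m|\le N$, extended linearly in $a$. For $0<q<1$ put $$\mathsf W_q(a,z)=q^{L_0/2}\,\mathcal Y(q^{L_0/2}a,z)\,q^{L_0/2},\qquad \mathsf W^{[N]}_q(a,z)=q^{L_0/2}\,\mathcal Y^{[N]}(q^{L_0/2}a,z)\,q^{L_0/2}.$$ A complex number $z\ne0$ is substituted for the formal variable by means of an arbitrary fixed choice of $\log z$, with $z^{s}=e^{s\log z}$. Let $S\subset A$ be a linear subspace and $S_{\mathsf{hom}}=\bigoplus_{n,\,\alpha\in I_A}(S\cap A_{n,\alpha})$. Suppose that $\mathcal Y$ is $S$-bounded with boundedness parameter $\vartheta$: for all $z\in\mathbb C\setminus\{0\}$ and $0<q<1$ there is given $\vartheta(q,z)\in[0,\infty]$ with $$\|\mathsf W_q(a,z)b\|^2\le\vartheta(q,z)^2\,\|a\|^2\,\|b\|^2\qquad(a\in S,\ b\in B),$$ and $\vartheta(q,z)<\infty$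 whenever $0<q<\min\{|z|^2,1/|z|^2\}$. (Here $\|\mathsf W_q(a,z)b\|^2\in[0,\infty]$ is the sum of the squared norms of the $L_0$-weight components; $0\cdot\infty=0$.) **Theorem.** There is a constant $\kappa>0$, depending only on the modules $A,B,C$, such that for every such $\mathcal Y$, $S$, $\vartheta$ and choice of logarithm, every $z\in\mathbb C\setminus\{0\}$, $0<q<\min\{|z|^2,1/|z|^2\}$, $N>0$ and $a\in S_{\mathsf{hom}}$, the series $\mathsf W_q(a,z)b$ and $\mathsf W^{[N]}_q(a,z)b$ converge in $\widehat C$ for all $b\in B$, they define bounded operators $\widehat B\to\widehat C$, and for all $0<q_1,q_2<1$ with $q_1q_2=q$ $$\bigl\|\mathsf W_q(a,z)-\mathsf W^{[N]}_q(a,z)\bigr\|\le\|a\|\cdot\kappa\cdot\vartheta(q_2,z)\,q_1^{N/2}\,\frac1{1-q_1}$$ in operator norm. In particular, with $q_1=q_2=\sqrt q$, $$\bigl\|\mathsf W_q(a,z)-\mathsf W^{[N]}_q(a,z)\bigr\|\le\|a\|\cdot\kappa\cdot\vartheta(\sqrt q,z)\,q^{N/4}\,\frac1{1-\sqrt q}.$$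 -/

import Mathlib

open scoped ENNReal NNReal InnerProductSpace ComplexConjugate

noncomputable section

namespace TruncatedIntertwiner

/-! ### Linear algebra of graded spaces -/

section Graded

variable {ι M N : Type*} [DecidableEq ι] [AddCommGroup M] [Module ℂ M]
  [AddCommGroup N] [Module ℂ N]

theorem bijective_coeLinearMap (𝒜 : ι → Submodule ℂ M) (h : DirectSum.IsInternal 𝒜) :
    Function.Bijective (DirectSum.coeLinearMap 𝒜) := h

/-- For a direct sum decomposition `M = ⨁ i, 𝒜 i` and linear maps `f i : M → N`, the linear map
`∑ i, f i ∘ P i`, where `P i` is the projection onto `𝒜 i`. -/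
def gradedSum (𝒜 : ι → Submodule ℂ M) (h : DirectSum.IsInternal 𝒜) (f : ι → M →ₗ[ℂ] N) :
    M →ₗ[ℂ] N :=
  (DirectSum.toModule ℂ ι N fun i => (f i).comp (𝒜 i).subtype) ∘ₗ
    (LinearEquiv.ofBijective _ (bijective_coeLinearMap 𝒜 h)).symm.toLinearMap

theorem gradedSum_of_mem (𝒜 : ι → Submodule ℂ M) (h : DirectSum.IsInternal 𝒜)
    (f : ι → M →ₗ[ℂ] N) {i : ι} {x : M} (hx : x ∈ 𝒜 i) : gradedSum 𝒜 h f x = f i x := by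
  have key : (LinearEquiv.ofBijective _ (bijective_coeLinearMap 𝒜 h)).symm x
      = DirectSum.lof ℂ ι (fun i => 𝒜 i) i ⟨x, hx⟩ := by
    rw [LinearEquiv.symm_apply_eq]
    simp
  simp [gradedSum, key]

end Graded

/-! ### Vertex operator algebras -/

/-- The Jacobi identity for mode operators `v_n` (coefficient of `z ^ (-n-1)`) of an algebra `V`
acting on `M`: take `z₂ ^ (-p-1)` coefficients in
`Res_{z₀} Y_M(Y(u,z₀)v,z₂) z₀ᵐ (z₂+z₀)ⁿ
  = Res_{z₁} Y_M(u,z₁)Y_M(v,z₂)(z₁-z₂)ᵐz₁ⁿ - Res_{z₁} Y_M(v,z₂)Y_M(u,z₁)(-z₂+z₁)ᵐz₁ⁿ`.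
All sums are finite by the lower truncation of the fields. -/
def JacobiIdentity {V M : Type*} [AddCommGroup V] [Module ℂ V] [AddCommGroup M] [Module ℂ M]
    (Y : V →ₗ[ℂ] (ℤ → Module.End ℂ V)) (YM : V →ₗ[ℂ] (ℤ → Module.End ℂ M)) : Prop :=
  ∀ (u v : V) (w : M) (m n p : ℤ),
    ∑ᶠ j : ℕ, Ring.choose n j • YM (Y u (m + j) v) (p + n - j) w =
      ∑ᶠ j : ℕ, ((-1 : ℤ) ^ j * Ring.choose m j) •
        (YM u (m + n - j) (YM v (p + j) w)
          - ((-1 : ℂ) ^ m) • YM v (p + m - j) (YM u (n + j) w))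

/-- The relations of the Virasoro algebra of central charge `c` for operators `L n`. -/
def VirasoroRelations {M : Type*} [AddCommGroup M] [Module ℂ M] (c : ℂ)
    (L : ℤ → Module.End ℂ M) : Prop :=
  ∀ m n : ℤ, L m * L n - L n * L m =
    ((m : ℂ) - n) • L (m + n)
      + (if m + n = 0 then c / 12 * m * ((m : ℂ) ^ 2 - 1) else 0) • (1 : Module.End ℂ M)

/-- A vertex operator algebra on the complex vector space `V`. `Y v n` is the mode `v_n`, that is
`Y(v,z) = ∑ n, v_n z ^ (-n-1)`. The Virasoro operators are `L n = ω_{n+1}`, and the weight space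
of weight `n : ℕ` is the `L 0`-eigenspace of eigenvalue `n`. -/
structure VOA (V : Type*) [AddCommGroup V] [Module ℂ V] where
  Y : V →ₗ[ℂ] (ℤ → Module.End ℂ V)
  vac : V
  ω : V
  c : ℂ
  truncation : ∀ u v : V, ∃ K : ℤ, ∀ n : ℤ, K ≤ n → Y u n v = 0
  vac_left : ∀ n : ℤ, Y vac n = if n = -1 then 1 else 0
  creation : ∀ u : V, Y u (-1) vac = u ∧ ∀ n : ℤ, 0 ≤ n → Y u n vac = 0
  grading : DirectSum.IsInternal fun n : ℕ => Module.End.eigenspace (Y ω 1) (n : ℂ)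
  finite_dim : ∀ n : ℕ, FiniteDimensional ℂ (Module.End.eigenspace (Y ω 1) (n : ℂ))
  vac_mem : vac ∈ Module.End.eigenspace (Y ω 1) ((0 : ℕ) : ℂ)
  ω_mem : ω ∈ Module.End.eigenspace (Y ω 1) ((2 : ℕ) : ℂ)
  virasoro : VirasoroRelations c fun n => Y ω (n + 1)
  translation : ∀ (v : V) (n : ℤ), Y (Y ω 0 v) n = -(n : ℂ) • Y v (n - 1)
  jacobi : JacobiIdentity Y Y

namespace VOA

variable {V : Type*} [AddCommGroup V] [Module ℂ V] (𝒱 : VOA V)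

/-- The Virasoro operator `L n` on the vertex operator algebra. -/
def L (n : ℤ) : Module.End ℂ V := 𝒱.Y 𝒱.ω (n + 1)

/-- The weight space `V_n`. -/
def weight (n : ℕ) : Submodule ℂ V := Module.End.eigenspace (𝒱.L 0) (n : ℂ)

end VOA

/-- A module of a vertex operator algebra, graded by levels `A = ⨁ n, A_n`, `n : ℕ`, where the
weights (eigenvalues of `L 0`) occurring at level `n` are of the form `α + n` with `α` in a finite
set `topWeights`. The level-zero space `A_0` is the top level and it generates the module; this
fixes the normalization of the level grading, and holds for a direct sum
`A = ⨁ i, A[i]` of irreducible modules, graded by `A_n = ⨁ i, A[i]_n` with `A[i]_0 ≠ 0`. -/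
structure VOAModule {V : Type*} [AddCommGroup V] [Module ℂ V] (𝒱 : VOA V)
    (A : Type*) [AddCommGroup A] [Module ℂ A] where
  Y : V →ₗ[ℂ] (ℤ → Module.End ℂ A)
  truncation : ∀ (v : V) (a : A), ∃ K : ℤ, ∀ n : ℤ, K ≤ n → Y v n a = 0
  vac_left : ∀ n : ℤ, Y 𝒱.vac n = if n = -1 then 1 else 0
  virasoro : VirasoroRelations 𝒱.c fun n => Y 𝒱.ω (n + 1)
  translation : ∀ (v : V) (n : ℤ), Y (𝒱.L (-1) v) n = -(n : ℂ) • Y v (n - 1)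
  jacobi : JacobiIdentity 𝒱.Y Y
  level : ℕ → Submodule ℂ A
  level_internal : DirectSum.IsInternal level
  topWeights : Finset ℂ
  level_weights : ∀ n : ℕ,
    level n ≤ ⨆ α ∈ topWeights, level n ⊓ Module.End.eigenspace (Y 𝒱.ω 1) (α + n)
  mode_level : ∀ (d : ℕ) (v : V), v ∈ 𝒱.weight d → ∀ (k : ℤ) (n : ℕ) (a : A), a ∈ level n →
    (∀ l : ℕ, (l : ℤ) = n + d - k - 1 → Y v k a ∈ level l) ∧
      ((n : ℤ) + d - k - 1 < 0 → Y v k a = 0)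
  top_generates : ∀ P : Submodule ℂ A, level 0 ≤ P →
    (∀ (v : V) (k : ℤ), ∀ a ∈ P, Y v k a ∈ P) → P = ⊤

namespace VOAModule

variable {V A : Type*} [AddCommGroup V] [Module ℂ V] {𝒱 : VOA V}
  [AddCommGroup A] [Module ℂ A] (MA : VOAModule 𝒱 A)

/-- The Virasoro operator `L n` on the module. -/
def L (n : ℤ) : Module.End ℂ A := MA.Y 𝒱.ω (n + 1)

/-- The refined grading: `A_{n,α}`, the vectors of level `n` and weight `α + n`. -/
def refinedLevel (n : ℕ) (α : ℂ) : Submodule ℂ A :=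
  MA.level n ⊓ Module.End.eigenspace (MA.L 0) (α + n)

theorem weights_internal :
    DirectSum.IsInternal fun w : ℂ => Module.End.eigenspace (MA.L 0) w := by
  refine DirectSum.isInternal_submodule_of_iSupIndep_of_iSup_eq_top
    (Module.End.eigenspaces_iSupIndep (MA.L 0)) ?_
  rw [eq_top_iff, ← MA.level_internal.submodule_iSup_eq_top]
  refine iSup_le fun n => (MA.level_weights n).trans ?_
  refine iSup₂_le fun α _ => inf_le_right.trans ?_
  exact le_iSup (fun w : ℂ => Module.End.eigenspace (MA.L 0) w) (α + n)

/-- The projection onto the space of weight `w`. -/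
def weightProj (w : ℂ) : Module.End ℂ A :=
  gradedSum _ MA.weights_internal fun μ => if μ = w then 1 else 0

/-- The operator `q ^ (L 0 / 2)`, multiplying vectors of weight `w` by `q ^ (w / 2)`. -/
def qHalfL0 (q : ℝ) : Module.End ℂ A :=
  gradedSum _ MA.weights_internal fun w => (q : ℂ) ^ (w / 2) • (1 : Module.End ℂ A)

/-- The projection onto level `l`, which is zero for `l < 0`. -/
def levelProj (l : ℤ) : Module.End ℂ A :=
  gradedSum _ MA.level_internal fun n => if (n : ℤ) = l then 1 else 0

/-- `S_hom = ⨁_{n, α} (S ∩ A_{n,α})`, the span of the homogeneous vectors of `S`. -/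
def homPart (S : Submodule ℂ A) : Submodule ℂ A :=
  ⨆ (n : ℕ), ⨆ α ∈ MA.topWeights, S ⊓ MA.refinedLevel n α

end VOAModule

/-! ### Unitarity -/

/-- Invariance of the inner product of `M`,
`⟨x, Y_M(e^{z L₁} (-z⁻²)^{L₀} v, z⁻¹) y⟩ = ⟨Y_M(φ(v), z) x, y⟩`,
as an identity of coefficients of `z ^ (-p-1)`, for `v` of weight `n`. The inner product is
antilinear in the first argument. -/
def InvariantInner {V M : Type*} [AddCommGroup V] [Module ℂ V] (𝒱 : VOA V)
    [NormedAddCommGroup M] [InnerProductSpace ℂ M]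
    (YM : V →ₗ[ℂ] (ℤ → Module.End ℂ M)) (φ : V → V) : Prop :=
  ∀ (n : ℕ) (v : V), v ∈ 𝒱.weight n → ∀ (p : ℤ) (x y : M),
    ⟪YM (φ v) p x, y⟫_ℂ = ∑ j ∈ Finset.range (n + 1),
      ((-1 : ℂ) ^ n / (j.factorial : ℂ)) * ⟪x, YM ((𝒱.L 1 ^ j) v) (2 * n - j - p - 2) y⟫_ℂ

/-- A unitary structure on a vertex operator algebra whose underlying space carries a positive
definite Hermitian form: an antilinear involutive automorphism `φ` for which the form is
invariant. -/
structure UnitaryStructure {V : Type*} [NormedAddCommGroup V] [InnerProductSpace ℂ V]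
    (𝒱 : VOA V) where
  φ : V →ₗ⋆[ℂ] V
  involutive : ∀ v, φ (φ v) = v
  map_vac : φ 𝒱.vac = 𝒱.vac
  map_ω : φ 𝒱.ω = 𝒱.ω
  map_mode : ∀ (v w : V) (n : ℤ), φ (𝒱.Y v n w) = 𝒱.Y (φ v) n (φ w)
  inner_map : ∀ v w : V, ⟪φ v, φ w⟫_ℂ = conj ⟪v, w⟫_ℂ
  invariant : InvariantInner 𝒱 𝒱.Y φ

/-- A module carrying a positive definite Hermitian form is unitary if the form is invariant. -/
def VOAModule.IsUnitary {V A : Type*} [NormedAddCommGroup V] [InnerProductSpace ℂ V]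
    {𝒱 : VOA V} [NormedAddCommGroup A] [InnerProductSpace ℂ A]
    (MA : VOAModule 𝒱 A) (U : UnitaryStructure 𝒱) : Prop :=
  InvariantInner 𝒱 MA.Y U.φ

/-! ### Intertwiners -/

/-- An intertwining operator `𝒴` of type `(C; A B)`: a series
`𝒴(a,z) b = ∑ s, (coeff s a b) z ^ (-s)` whose exponents `s` lie in `I + ℤ` for a finite set `I` of
complex numbers, satisfying lower truncation, the translation property and the Jacobi identity
(written for the coefficient of `z₂ ^ (-s)`). -/
structure Intertwiner {V A B C : Type*} [AddCommGroup V] [Module ℂ V] {𝒱 : VOA V}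
    [AddCommGroup A] [Module ℂ A] [AddCommGroup B] [Module ℂ B] [AddCommGroup C] [Module ℂ C]
    (MA : VOAModule 𝒱 A) (MB : VOAModule 𝒱 B) (MC : VOAModule 𝒱 C) where
  coeff : ℂ → A →ₗ[ℂ] B →ₗ[ℂ] C
  exponents : ∃ I : Finset ℂ, ∀ s : ℂ, coeff s ≠ 0 → ∃ τ ∈ I, ∃ m : ℤ, s = τ + m
  truncation : ∀ (a : A) (b : B) (τ : ℂ), ∃ K : ℤ, ∀ m : ℤ, K ≤ m → coeff (τ + m) a b = 0
  translation : ∀ (a : A) (s : ℂ), coeff s (MA.L (-1) a) = -(s - 1) • coeff (s - 1) a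
  jacobi : ∀ (v : V) (a : A) (b : B) (m n : ℤ) (s : ℂ),
    ∑ᶠ j : ℕ, Ring.choose n j • coeff (s + n - j) (MA.Y v (m + j) a) b =
      ∑ᶠ j : ℕ, ((-1 : ℤ) ^ j * Ring.choose m j) •
        (MC.Y v (m + n - j) (coeff (s + j) a b)
          - ((-1 : ℂ) ^ m) • coeff (s + m - j) a (MB.Y v (n + j) b))

namespace Intertwiner

section Algebraic

variable {V A B C : Type*} [AddCommGroup V] [Module ℂ V] {𝒱 : VOA V}
  [AddCommGroup A] [Module ℂ A] [AddCommGroup B] [Module ℂ B] [AddCommGroup C] [Module ℂ C]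
  {MA : VOAModule 𝒱 A} {MB : VOAModule 𝒱 B} {MC : VOAModule 𝒱 C} (𝒴 : Intertwiner MA MB MC)

/-- The set `I = {α + β - γ}` of exponents attached to the three modules; for irreducible modules
it is `{h_A + h_B - h_C}`. -/
def exponentSet (_ : Intertwiner MA MB MC) : Finset ℂ :=
  (MA.topWeights ×ˢ MB.topWeights ×ˢ MC.topWeights).image fun t => t.1 + t.2.1 - t.2.2

/-- For `a` of level `n`, the mode `y(a)_{τ,m}`: the part of the coefficient of `z ^ (-m-τ-n)` in
`𝒴(a,z)` that maps `B_k` into `C_{k-m}` for every `k`. -/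
def mode (τ : ℂ) (m : ℤ) (n : ℕ) (a : A) : B →ₗ[ℂ] C :=
  gradedSum _ MB.level_internal fun k =>
    (MC.levelProj (k - m)).comp (𝒴.coeff (m + τ + n) a)

/-- The truncated intertwiner `𝒴^{[N]}(a,z) = ∑_{τ ∈ I, |m| ≤ N} y(a)_{τ,m} z ^ (-m-τ-n)` for `a`
of level `n`, extended linearly in `a`: this is its coefficient of `z ^ (-s)`. -/
def truncated (N : ℝ) (a : A) (s : ℂ) : B →ₗ[ℂ] C :=
  ∑ᶠ n : ℕ, ∑ τ ∈ 𝒴.exponentSet, ∑ m ∈ Finset.Icc (-⌊N⌋) ⌊N⌋,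
    if s = m + τ + n then 𝒴.mode τ m n (MA.levelProj n a) else 0

/-- The scaled intertwiner `W_q(a,z) = q ^ (L₀/2) 𝒴(q ^ (L₀/2) a, z) q ^ (L₀/2)`: its coefficient
of `z ^ (-s)`. -/
def scaled (q : ℝ) (a : A) (s : ℂ) : B →ₗ[ℂ] C :=
  MC.qHalfL0 q ∘ₗ 𝒴.coeff s (MA.qHalfL0 q a) ∘ₗ MB.qHalfL0 q

/-- The truncated scaled intertwiner
`W_q^{[N]}(a,z) = q ^ (L₀/2) 𝒴^{[N]}(q ^ (L₀/2) a, z) q ^ (L₀/2)`: its coefficient of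
`z ^ (-s)`. -/
def scaledTruncated (N q : ℝ) (a : A) (s : ℂ) : B →ₗ[ℂ] C :=
  MC.qHalfL0 q ∘ₗ 𝒴.truncated N (MA.qHalfL0 q a) s ∘ₗ MB.qHalfL0 q

end Algebraic

section Analytic

variable {V A B C : Type*} [AddCommGroup V] [Module ℂ V] {𝒱 : VOA V}
  [NormedAddCommGroup A] [InnerProductSpace ℂ A] [NormedAddCommGroup B] [InnerProductSpace ℂ B]
  [NormedAddCommGroup C] [InnerProductSpace ℂ C]
  {MA : VOAModule 𝒱 A} {MB : VOAModule 𝒱 B} {MC : VOAModule 𝒱 C} (𝒴 : Intertwiner MA MB MC)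

/-- The diagonal value `⟨a ⊗ b, a ⊗ b⟩_{𝒴,q,z} = ‖W_q(a,z) b‖²` of the form attached to `𝒴`, in
`[0, ∞]`, with `z ^ (-s) = exp (-s log z)` for a chosen branch `lg` of the logarithm. For a complex
number `z`, `W_q(a,z) b` is a family of vectors indexed by the weights `w` of `C` (the inner sum
over `s` is finite); weight spaces are orthogonal, so its squared norm is the sum of the squared
norms of its weight components. -/
def form (lg : ℂ → ℂ) (q : ℝ) (z : ℂ) (a : A) (b : B) : ℝ≥0∞ :=
  ∑' w : ℂ, ‖∑ᶠ s : ℂ, Complex.exp (-s * lg z) • MC.weightProj w (𝒴.scaled q a s b)‖ₑ ^ 2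

/-- `θ` is a boundedness parameter showing that `𝒴` is `S`-bounded:
`⟨a ⊗ b, a ⊗ b⟩_{𝒴,q,z} ≤ θ(q,z)² ‖a‖² ‖b‖²` for `a ∈ S`, `b ∈ B`, where `θ(q,z)` is finite whenever
`0 < q < min {|z|², 1/|z|²}`. For other `q ∈ (0,1)` the value `∞` is allowed. -/
def IsBoundednessParameter (lg : ℂ → ℂ) (S : Submodule ℂ A) (θ : ℝ → ℂ → ℝ≥0∞) : Prop :=
  ∀ z : ℂ, z ≠ 0 → ∀ q : ℝ, 0 < q → q < 1 →
    (∀ a ∈ S, ∀ b : B, 𝒴.form lg q z a b ≤ θ q z ^ 2 * ‖a‖ₑ ^ 2 * ‖b‖ₑ ^ 2) ∧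
    (q < min (‖z‖ ^ 2) (1 / ‖z‖ ^ 2) → θ q z < ∞)

end Analytic

end Intertwiner

/-- The bounded operator `T` between the Hilbert space completions is the series
`F(z) = ∑ s, F_s z ^ (-s)` with the formal variable replaced by the complex number `z`: for every
`b ∈ B`, the series `∑ s, z ^ (-s) F_s b` converges to `T b`. (As `B` is dense, `T` is unique.) -/
def IsValueAt {B C : Type*} [NormedAddCommGroup B] [InnerProductSpace ℂ B]
    [NormedAddCommGroup C] [InnerProductSpace ℂ C] (lg : ℂ → ℂ) (F : ℂ → B →ₗ[ℂ] C) (z : ℂ)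
    (T : UniformSpace.Completion B →L[ℂ] UniformSpace.Completion C) : Prop :=
  ∀ b : B, HasSum
    (fun s : ℂ => ((Complex.exp (-s * lg z) • F s b : C) : UniformSpace.Completion C))
    (T (b : UniformSpace.Completion B))

end TruncatedIntertwiner

end

/-!
The operator `W_q(a,z)` is compared with its truncation through its matrix entries between levels.
For a factorization `q = q₁ q₂` one has
`W_q(a,z) = q₁ ^ (L₀/2) W_{q₂}(q₁ ^ (L₀/2) a, z) q₁ ^ (L₀/2)`.
On level `k` of a unitary module all weights are real and at least `k`, so `q₁ ^ (L₀/2)` has norm at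
most `q₁ ^ (k/2)` there (`VOAModule.norm_qHalfL0_level_le`). The matrix entry of `W_q(a,z)` from
level `k` to level `l` is therefore bounded by `θ(q₂,z) ‖a‖ q₁ ^ ((k+l)/2)`. Truncation removes
exactly the entries with `|k - l| > N`, where `k > N` or `l > N`, and the Hilbert–Schmidt norm of
these bounds is at most `2 q₁ ^ (N/2) / (1 - q₁)` times `θ(q₂,z) ‖a‖`
(`Intertwiner.norm_seriesMap_sub_le`). So `κ = 2` serves for all modules.

The argument uses two facts on a unitary module, both deduced from generation by the top level.
First, distinct levels are orthogonal (`VOAModule.IsUnitary.inner_levelProj_of_lt`), although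
distinct levels can share weights. Second, the module is spanned by vectors of weight `α + n` at
level `n` with `α ≥ 0` real (`VOAModule.IsUnitary.iSup_refinedLevel`), because
`‖L₋₁ x‖² = 2 α ‖x‖²` at level zero and modes preserve `α`.

Convergence holds because, for homogeneous `a` and `b`, the terms of the series `W_q(a,z) b` lie in
pairwise orthogonal weight spaces, and the form `⟨a ⊗ b, a ⊗ b⟩_{𝒴,q,z}` is the sum of their squared
norms (`Intertwiner.summable_scaled_of_weight`). On level `k` the truncated series is a finite sum
of level projections of the full series (`Intertwiner.scaledTruncated_apply`), since each level
shift occurs for at most one exponent `τ`.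
-/

namespace TruncatedIntertwiner

/-! ### Orthogonal decompositions -/

section Orthogonal

variable {ι E : Type*} [NormedAddCommGroup E] [InnerProductSpace ℂ E] {G : ι → Submodule ℂ E}

theorem exists_finset_sum_eq (h : ⨆ i, G i = ⊤) (x : E) :
    ∃ (F : Finset ι) (f : ∀ i, G i), ∑ i ∈ F, (f i : E) = x := by
  obtain ⟨f, hf, hx⟩ := (Submodule.mem_iSup_iff_exists_finsupp G x).1 (h ▸ Submodule.mem_top)
  exact ⟨f.support, fun i => ⟨f i, hf i⟩, hx⟩

theorem norm_sq_sum_of_orthogonal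
    (hG : OrthogonalFamily ℂ (fun i => G i) fun i => (G i).subtypeₗᵢ)
    (F : Finset ι) (f : ι → E) (hf : ∀ i, f i ∈ G i) :
    ‖∑ i ∈ F, f i‖ ^ 2 = ∑ i ∈ F, ‖f i‖ ^ 2 :=
  hG.norm_sum (fun i => ⟨f i, hf i⟩) F

theorem norm_diagonal_le (hG : OrthogonalFamily ℂ (fun i => G i) fun i => (G i).subtypeₗᵢ)
    {D : E →ₗ[ℂ] E} {c : ι → ℂ} (hD : ∀ i, ∀ x ∈ G i, D x = c i • x) {M : ℝ}
    (hc : ∀ i, ‖c i‖ ≤ M) (hM : 0 ≤ M) {x : E} (hx : x ∈ ⨆ i, G i) : ‖D x‖ ≤ M * ‖x‖ := by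
  obtain ⟨f, hf, rfl⟩ := (Submodule.mem_iSup_iff_exists_finsupp G x).1 hx
  have h1 : D (∑ i ∈ f.support, f i) = ∑ i ∈ f.support, c i • f i := by
    rw [map_sum]
    exact Finset.sum_congr rfl fun i _ => hD i _ (hf i)
  rw [Finsupp.sum]
  rw [← sq_le_sq₀ (norm_nonneg _) (by positivity), mul_pow, h1,
    norm_sq_sum_of_orthogonal hG _ _ hf,
    norm_sq_sum_of_orthogonal hG _ (fun i => c i • f i) fun i => (G i).smul_mem _ (hf i),
    Finset.mul_sum]
  refine Finset.sum_le_sum fun i _ => ?_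
  rw [norm_smul, mul_pow]
  gcongr
  exact hc i

/-- Vectors of the Hilbert space completion are estimated by pairing them with the summands of an
orthogonal decomposition of the dense subspace. -/
theorem norm_completion_le_of_inner_le (h : ⨆ i, G i = ⊤)
    (hG : OrthogonalFamily ℂ (fun i => G i) fun i => (G i).subtypeₗᵢ)
    {y : UniformSpace.Completion E} {r : ι → ℝ} {M : ℝ} (hM : 0 ≤ M)
    (hy : ∀ i, ∀ c ∈ G i, ‖⟪(c : UniformSpace.Completion E), y⟫_ℂ‖ ≤ r i * ‖c‖)
    (hr : ∀ F : Finset ι, ∑ i ∈ F, r i ^ 2 ≤ M ^ 2) : ‖y‖ ≤ M := by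
  have key : ∀ x : UniformSpace.Completion E, ‖⟪x, y⟫_ℂ‖ ≤ M * ‖x‖ := by
    intro x
    induction x using UniformSpace.Completion.induction_on with
    | hp => exact isClosed_le (by fun_prop) (by fun_prop)
    | ih c =>
      obtain ⟨F, f, rfl⟩ := exists_finset_sum_eq h c
      have hn := norm_sq_sum_of_orthogonal hG F (fun i => (f i : E)) fun i => (f i).2
      have h1 : ((∑ i ∈ F, (f i : E) : E) : UniformSpace.Completion E)
          = ∑ i ∈ F, ((f i : E) : UniformSpace.Completion E) :=
        map_sum (UniformSpace.Completion.toComplₗᵢ (𝕜 := ℂ) (E := E)) _ _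
      rw [UniformSpace.Completion.norm_coe, h1, sum_inner]
      calc ‖∑ i ∈ F, ⟪((f i : E) : UniformSpace.Completion E), y⟫_ℂ‖
          ≤ ∑ i ∈ F, r i * ‖(f i : E)‖ :=
            (norm_sum_le _ _).trans (Finset.sum_le_sum fun i _ => hy i _ (f i).2)
        _ ≤ √(∑ i ∈ F, r i ^ 2) * √(∑ i ∈ F, ‖(f i : E)‖ ^ 2) :=
            Real.sum_mul_le_sqrt_mul_sqrt _ _ _
        _ ≤ M * ‖∑ i ∈ F, (f i : E)‖ := by
            rw [← hn, Real.sqrt_sq (norm_nonneg _)]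
            gcongr
            exact Real.sqrt_le_iff.2 ⟨hM, hr F⟩
  have h2 := key y
  rw [inner_self_eq_norm_sq_to_K] at h2
  rcases (norm_nonneg y).eq_or_lt with h0 | h0
  · rwa [← h0]
  · have h3 : ‖y‖ * ‖y‖ ≤ M * ‖y‖ := by simpa [sq] using h2
    exact le_of_mul_le_mul_right h3 h0

end Orthogonal

/-! ### The Virasoro action on vertex operator algebras and their modules -/

section Virasoro

variable {V A : Type*} [AddCommGroup V] [Module ℂ V] {𝒱 : VOA V} [AddCommGroup A] [Module ℂ A]

theorem finsum_choose_one_smul {M : Type*} [AddCommGroup M] (f : ℕ → M) :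
    ∑ᶠ j : ℕ, Ring.choose (1 : ℤ) j • f j = f 0 + f 1 := by
  rw [finsum_eq_sum_of_support_subset (s := {0, 1})]
  · simp
  · intro j hj
    contrapose! hj
    have h : j ≠ 0 ∧ j ≠ 1 := by simpa using hj
    have : Ring.choose (1 : ℤ) j = 0 := by
      rw [show (1 : ℤ) = ((1 : ℕ) : ℤ) by norm_num, Ring.choose_natCast,
        Nat.choose_eq_zero_of_lt (by omega), Nat.cast_zero]
    simp [this]

theorem finsum_choose_zero_smul {M : Type*} [AddCommGroup M] (f : ℕ → M) :
    ∑ᶠ j : ℕ, ((-1 : ℤ) ^ j * Ring.choose (0 : ℤ) j) • f j = f 0 := by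
  rw [finsum_eq_single _ 0 fun j hj => by simp [Ring.choose_zero_ite, hj]]
  simp

theorem VOA.L_one_ω : 𝒱.L 1 𝒱.ω = 0 := by
  have h := LinearMap.congr_fun (𝒱.virasoro 1 (-2)) 𝒱.vac
  have h2 := (𝒱.creation 𝒱.ω).2 2 (by norm_num)
  have h0 := (𝒱.creation 𝒱.ω).2 0 (by norm_num)
  have h1 := (𝒱.creation 𝒱.ω).1
  norm_num [h0, h1, h2] at h
  simpa [VOA.L] using h

theorem VOA.L_one_mem_weight {n : ℕ} {v : V} (hv : v ∈ 𝒱.weight (n + 1)) :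
    𝒱.L 1 v ∈ 𝒱.weight n := by
  have h := LinearMap.congr_fun (𝒱.virasoro 0 1) v
  rw [VOA.weight, Module.End.mem_eigenspace_iff] at hv ⊢
  simp only [VOA.L] at hv ⊢
  norm_num at h hv ⊢
  rw [hv, map_smul] at h
  rw [sub_eq_iff_eq_add.1 h]
  module

theorem VOA.L_one_pow_mem_weight {n : ℕ} {v : V} (hv : v ∈ 𝒱.weight n) {j : ℕ} (hj : j ≤ n) :
    (𝒱.L 1 ^ j) v ∈ 𝒱.weight (n - j) := by
  induction j with
  | zero => simpa using hv
  | succ j ih =>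
    rw [pow_succ', Module.End.mul_apply]
    refine VOA.L_one_mem_weight ?_
    rw [show n - (j + 1) + 1 = n - j by omega]
    exact ih (by omega)

theorem VOA.induction_weight {p : V → Prop} (h0 : p 0) (hadd : ∀ u v, p u → p v → p (u + v))
    (hom : ∀ d, ∀ v ∈ 𝒱.weight d, p v) (v : V) : p v := by
  have hv : v ∈ ⨆ d : ℕ, 𝒱.weight d := by
    have := 𝒱.grading.submodule_iSup_eq_top
    simp only [VOA.weight, VOA.L]
    norm_num
    rw [this]
    trivial
  exact Submodule.iSup_induction _ (motive := p) hv hom h0 hadd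

namespace VOAModule

variable (MA : VOAModule 𝒱 A)

theorem L_zero_mode {d : ℕ} {v : V} (hv : v ∈ 𝒱.weight d) (k : ℤ) (a : A) :
    MA.L 0 (MA.Y v k a) = MA.Y v k (MA.L 0 a) + ((d : ℂ) - k - 1) • MA.Y v k a := by
  have h := MA.jacobi 𝒱.ω v a 0 1 k
  rw [finsum_choose_one_smul, finsum_choose_zero_smul] at h
  rw [VOA.weight, Module.End.mem_eigenspace_iff] at hv
  have ht := MA.translation v (k + 1)
  simp only [VOA.L] at ht hv
  norm_num at h hv ht
  rw [hv, ht] at h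
  simp only [L]
  norm_num at h ⊢
  rw [sub_eq_iff_eq_add.1 h.symm]
  module

end VOAModule

end Virasoro

/-! ### Level and weight decomposition of unitary modules -/

namespace VOAModule

section Algebraic

variable {V A : Type*} [AddCommGroup V] [Module ℂ V] {𝒱 : VOA V} [AddCommGroup A] [Module ℂ A]
  (MA : VOAModule 𝒱 A)

theorem levelProj_of_mem {n : ℕ} {x : A} (hx : x ∈ MA.level n) (l : ℤ) :
    MA.levelProj l x = if (n : ℤ) = l then x else 0 := by
  rw [levelProj, gradedSum_of_mem _ _ _ hx]
  split_ifs <;> simp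

theorem weightProj_of_mem {μ : ℂ} {x : A} (hx : x ∈ Module.End.eigenspace (MA.L 0) μ) (w : ℂ) :
    MA.weightProj w x = if μ = w then x else 0 := by
  rw [weightProj, gradedSum_of_mem _ _ _ hx]
  split_ifs <;> simp

theorem qHalfL0_of_mem {w : ℂ} {x : A} (hx : x ∈ Module.End.eigenspace (MA.L 0) w) (q : ℝ) :
    MA.qHalfL0 q x = (q : ℂ) ^ (w / 2) • x := by
  rw [qHalfL0, gradedSum_of_mem _ _ _ hx]
  simp

theorem induction_level {p : A → Prop} (h0 : p 0) (hadd : ∀ x y, p x → p y → p (x + y))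
    (hom : ∀ n, ∀ x ∈ MA.level n, p x) (x : A) : p x :=
  Submodule.iSup_induction _ (motive := p)
    (MA.level_internal.submodule_iSup_eq_top ▸ Submodule.mem_top : x ∈ iSup MA.level) hom h0 hadd

theorem levelProj_of_neg {l : ℤ} (hl : l < 0) : MA.levelProj l = 0 := by
  ext x
  refine MA.induction_level (p := fun x => MA.levelProj l x = 0) (map_zero _)
    (fun x y hx hy => by rw [map_add, hx, hy, add_zero]) (fun n x hx => ?_) x
  rw [MA.levelProj_of_mem hx, if_neg (by omega)]

theorem levelProj_mem (n : ℕ) (x : A) : MA.levelProj n x ∈ MA.level n := by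
  refine MA.induction_level (p := fun x => MA.levelProj n x ∈ MA.level n)
    (by simp) (fun x y hx hy => by rw [map_add]; exact add_mem hx hy) (fun k x hx => ?_) x
  rw [MA.levelProj_of_mem hx]
  split_ifs with h
  · rwa [← Nat.cast_injective h]
  · exact zero_mem _

theorem mem_level_iff {n : ℕ} {x : A} : x ∈ MA.level n ↔ MA.levelProj n x = x :=
  ⟨fun h => by rw [MA.levelProj_of_mem h, if_pos rfl], fun h => h ▸ MA.levelProj_mem n x⟩

/-- A mode of a vector of weight `d` shifts levels by `d - k - 1`. -/
theorem levelProj_mode {d : ℕ} {v : V} (hv : v ∈ 𝒱.weight d) (k l : ℤ) (x : A) :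
    MA.levelProj l (MA.Y v k x) = MA.Y v k (MA.levelProj (l - (d - k - 1)) x) := by
  refine MA.induction_level (p := fun x => MA.levelProj l (MA.Y v k x)
    = MA.Y v k (MA.levelProj (l - (d - k - 1)) x)) (by simp)
    (fun x y hx hy => by simp only [map_add, hx, hy]) (fun n x hx => ?_) x
  obtain ⟨h1, h2⟩ := MA.mode_level d v hv k n x hx
  rw [MA.levelProj_of_mem hx]
  rcases lt_or_ge ((n : ℤ) + d - k - 1) 0 with h | h
  · rw [h2 h]
    split_ifs
    · rw [h2 h, map_zero]
    · simp
  · obtain ⟨m, hm⟩ := Int.eq_ofNat_of_zero_le h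
    rw [MA.levelProj_of_mem (h1 m hm.symm)]
    have : (m : ℤ) = n + d - k - 1 := hm.symm
    by_cases hml : (m : ℤ) = l
    · rw [if_pos hml, if_pos (by omega)]
    · rw [if_neg hml, if_neg (by omega), map_zero]

theorem exists_sum_levelProj (x : A) :
    ∃ F : Finset ℕ, (∀ n ∉ F, MA.levelProj n x = 0) ∧ ∑ n ∈ F, MA.levelProj n x = x := by
  classical
  have key : ∃ F : Finset ℕ, ∀ n ∉ F, MA.levelProj n x = 0 := by
    refine MA.induction_level (p := fun x => ∃ F : Finset ℕ, ∀ n ∉ F, MA.levelProj n x = 0)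
      ⟨∅, by simp⟩ ?_ (fun n x hx => ⟨{n}, fun k hk => ?_⟩) x
    · rintro x y ⟨F, hF⟩ ⟨G, hG⟩
      refine ⟨F ∪ G, fun n hn => ?_⟩
      rw [Finset.notMem_union] at hn
      rw [map_add, hF n hn.1, hG n hn.2, add_zero]
    · rw [MA.levelProj_of_mem hx, if_neg]
      rintro h
      exact hk (by simp [Nat.cast_injective h])
  have full : ∃ F : Finset ℕ, ∀ G : Finset ℕ, F ⊆ G → ∑ n ∈ G, MA.levelProj n x = x := by
    refine MA.induction_level (p := fun x => ∃ F : Finset ℕ, ∀ G : Finset ℕ, F ⊆ G →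
      ∑ n ∈ G, MA.levelProj n x = x) ⟨∅, by simp⟩ ?_ (fun n x hx => ⟨{n}, fun G hG => ?_⟩) x
    · rintro x y ⟨F, hF⟩ ⟨G, hG⟩
      refine ⟨F ∪ G, fun H hH => ?_⟩
      simp only [map_add, Finset.sum_add_distrib]
      rw [hF H (Finset.union_subset_left hH), hG H (Finset.union_subset_right hH)]
    · rw [Finset.sum_congr rfl fun (k : ℕ) _ => MA.levelProj_of_mem hx k]
      simp only [Nat.cast_inj]
      rw [Finset.sum_ite_eq, if_pos (hG (by simp))]
  obtain ⟨F, hF⟩ := key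
  obtain ⟨G, hG⟩ := full
  exact ⟨F ∪ G, fun n hn => hF n fun h => hn (Finset.mem_union_left _ h),
    hG _ Finset.subset_union_right⟩

end Algebraic

section Unitary

variable {V A : Type*} [NormedAddCommGroup V] [InnerProductSpace ℂ V] {𝒱 : VOA V}
  {U : UnitaryStructure 𝒱} [NormedAddCommGroup A] [InnerProductSpace ℂ A]
  {MA : VOAModule 𝒱 A}

theorem _root_.TruncatedIntertwiner.UnitaryStructure.φ_mem_weight (U : UnitaryStructure 𝒱)
    {d : ℕ} {v : V} (hv : v ∈ 𝒱.weight d) : U.φ v ∈ 𝒱.weight d := by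
  rw [VOA.weight, Module.End.mem_eigenspace_iff] at hv ⊢
  have h := U.map_mode 𝒱.ω v 1
  simp only [VOA.L] at hv ⊢
  norm_num at hv ⊢
  rw [hv, U.map_ω] at h
  rw [← h, LinearMap.map_smulₛₗ]
  simp

/-- Since `L₁ ω = 0`, only the first term of the invariance formula for `ω` survives. -/
theorem IsUnitary.inner_L_zero (hA : MA.IsUnitary U) (x y : A) :
    ⟪MA.L 0 x, y⟫_ℂ = ⟪x, MA.L 0 y⟫_ℂ := by
  have h := hA 2 𝒱.ω 𝒱.ω_mem 1 x y
  have h1 : 𝒱.L 1 𝒱.ω = 0 := VOA.L_one_ω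
  rw [U.map_ω] at h
  simpa [Finset.sum_range_succ, h1, pow_two, L] using h

theorem IsUnitary.inner_L_neg_one (hA : MA.IsUnitary U) (x y : A) :
    ⟪MA.L (-1) x, y⟫_ℂ = ⟪x, MA.L 1 y⟫_ℂ := by
  have h := hA 2 𝒱.ω 𝒱.ω_mem 0 x y
  have h1 : 𝒱.L 1 𝒱.ω = 0 := VOA.L_one_ω
  rw [U.map_ω] at h
  simpa [Finset.sum_range_succ, h1, pow_two, L] using h

/-- The formal adjoint of `v_k`, for `v` of weight `d`, is a linear combination of modes that shift
levels by `-(d - k - 1)`. -/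
theorem IsUnitary.inner_mode_eq_zero (hA : MA.IsUnitary U) {d : ℕ} {v : V}
    (hv : v ∈ 𝒱.weight d) (k : ℤ) {x y : A}
    (h : ∀ (e : ℕ) (u : V) (j : ℤ), u ∈ 𝒱.weight e → (e : ℤ) - j - 1 = -(d - k - 1) →
      ⟪x, MA.Y u j y⟫_ℂ = 0) : ⟪MA.Y v k x, y⟫_ℂ = 0 := by
  have h1 := hA d (U.φ v) (U.φ_mem_weight hv) k x y
  rw [U.involutive] at h1
  rw [h1]
  refine Finset.sum_eq_zero fun j hj => ?_
  have hj : j ≤ d := by simpa [Nat.lt_succ_iff] using hj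
  rw [h (d - j) _ _ (VOA.L_one_pow_mem_weight (U.φ_mem_weight hv) hj) (by omega), mul_zero]

/-- Levels are orthogonal: for `l < n` the vectors `x` whose level `n` component is orthogonal to
level `l` form a submodule, since the adjoint of a mode shifts levels the opposite way, and it
contains the top level. -/
theorem IsUnitary.inner_levelProj_of_lt (hA : MA.IsUnitary U) (x y : A) {l n : ℤ} (hln : l < n) :
    ⟪MA.levelProj n x, MA.levelProj l y⟫_ℂ = 0 := by
  let P : Submodule ℂ A :=
    { carrier := {x | ∀ (l n : ℤ), l < n → ∀ y, ⟪MA.levelProj n x, MA.levelProj l y⟫_ℂ = 0}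
      zero_mem' := by simp
      add_mem' := fun {a b} ha hb l n hln y => by
        rw [map_add, inner_add_left, ha l n hln, hb l n hln, add_zero]
      smul_mem' := fun c a ha l n hln y => by
        rw [map_smul, inner_smul_left, ha l n hln, mul_zero] }
  have hP : P = ⊤ := by
    refine MA.top_generates P (fun x hx l n hln y => ?_) (fun v k a ha => ?_)
    · rw [MA.levelProj_of_mem hx]
      split_ifs with h
      · rw [MA.levelProj_of_neg (l := l) (by simp at h; omega)]
        simp
      · simp
    · refine VOA.induction_weight (𝒱 := 𝒱) (p := fun v => MA.Y v k a ∈ P) (by simp)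
        (fun u v hu hv => by simpa using P.add_mem hu hv) (fun d v hv l n hln y => ?_) v
      rw [MA.levelProj_mode hv]
      refine hA.inner_mode_eq_zero hv k fun e u j hu hj => ?_
      have := MA.levelProj_mode hu j (l - (d - k - 1)) y
      rw [show l - (d - k - 1) - (e - j - 1) = l by omega] at this
      rw [← this]
      exact ha _ _ (by omega) _
  have : x ∈ P := hP ▸ Submodule.mem_top
  exact this l n hln y

theorem IsUnitary.inner_level (hA : MA.IsUnitary U) {n k : ℕ} (hnk : n ≠ k) {x y : A}
    (hx : x ∈ MA.level n) (hy : y ∈ MA.level k) : ⟪x, y⟫_ℂ = 0 := by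
  rw [← MA.mem_level_iff.1 hx, ← MA.mem_level_iff.1 hy]
  rcases hnk.lt_or_gt with h | h
  · rw [← inner_conj_symm, hA.inner_levelProj_of_lt y x (by exact_mod_cast h), map_zero]
  · exact hA.inner_levelProj_of_lt x y (by exact_mod_cast h)

theorem IsUnitary.orthogonalFamily_level (hA : MA.IsUnitary U) :
    OrthogonalFamily ℂ (fun n => MA.level n) fun n => (MA.level n).subtypeₗᵢ :=
  fun _ _ hnk x y => hA.inner_level hnk x.2 y.2

theorem IsUnitary.inner_weight (hA : MA.IsUnitary U) {w w' : ℂ} (hw : w ≠ w') {x y : A}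
    (hx : x ∈ Module.End.eigenspace (MA.L 0) w) (hy : y ∈ Module.End.eigenspace (MA.L 0) w') :
    ⟪x, y⟫_ℂ = 0 :=
  LinearMap.IsSymmetric.orthogonalFamily_eigenspaces (T := MA.L 0) hA.inner_L_zero hw
    ⟨x, hx⟩ ⟨y, hy⟩

theorem IsUnitary.orthogonalFamily_weight (hA : MA.IsUnitary U) :
    OrthogonalFamily ℂ (fun w => Module.End.eigenspace (MA.L 0) w)
      fun w => (Module.End.eigenspace (MA.L 0) w).subtypeₗᵢ :=
  LinearMap.IsSymmetric.orthogonalFamily_eigenspaces (T := MA.L 0) hA.inner_L_zero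

end Unitary

variable {V A : Type*} [NormedAddCommGroup V] [InnerProductSpace ℂ V] {𝒱 : VOA V}
  {U : UnitaryStructure 𝒱} [NormedAddCommGroup A] [InnerProductSpace ℂ A]
  {MA : VOAModule 𝒱 A}

/-! ### Non-negativity of the top weights -/

/-- The top weight of a non-zero vector `x` at level zero is non-negative, since
`‖L₋₁ x‖² = ⟪x, L₁ L₋₁ x⟫ = 2 α ‖x‖²`. -/
theorem IsUnitary.exists_nonneg_of_mem_zero (hA : MA.IsUnitary U) {α : ℂ} {x : A}
    (hx : x ∈ MA.refinedLevel 0 α) (hx0 : x ≠ 0) : ∃ r : ℝ, 0 ≤ r ∧ α = r := by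
  have hL : MA.L 0 x = α • x := by simpa using Module.End.mem_eigenspace_iff.1 hx.2
  have hxx : ⟪x, x⟫_ℂ ≠ 0 := inner_self_ne_zero.2 hx0
  have hreal : conj α = α := by
    have h := hA.inner_L_zero x x
    rw [hL, inner_smul_left, inner_smul_right] at h
    exact mul_right_cancel₀ hxx h
  obtain ⟨r, rfl⟩ := Complex.conj_eq_iff_real.1 hreal
  have h1 : MA.L 1 x = 0 := (MA.mode_level 2 𝒱.ω 𝒱.ω_mem (1 + 1) 0 x hx.1).2 (by norm_num)
  have hc : MA.L 1 (MA.L (-1) x) = (2 * r : ℂ) • x := by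
    have h := LinearMap.congr_fun (MA.virasoro 1 (-1)) x
    have h1' : MA.Y 𝒱.ω (1 + 1) x = 0 := h1
    have hL' : MA.Y 𝒱.ω (0 + 1) x = (r : ℂ) • x := hL
    simp only [L]
    norm_num at h h1' hL' ⊢
    rw [h1', hL'] at h
    rw [map_zero, sub_zero] at h
    rw [h]
    module
  have hn := hA.inner_L_neg_one x (MA.L (-1) x)
  rw [hc, inner_smul_right, inner_self_eq_norm_sq_to_K, inner_self_eq_norm_sq_to_K] at hn
  have hn' : ‖MA.L (-1) x‖ ^ 2 = 2 * r * ‖x‖ ^ 2 := Complex.ofReal_injective (by simpa using hn)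
  have hpos : 0 < ‖x‖ ^ 2 := by positivity
  refine ⟨r, ?_, rfl⟩
  nlinarith [sq_nonneg ‖MA.L (-1) x‖]

variable (MA) in
/-- The non-negative real top weights of a module. -/
def nonnegTopWeights : Set ℂ := {α | α ∈ MA.topWeights ∧ ∃ r : ℝ, 0 ≤ r ∧ α = r}

theorem mode_mem_refinedLevel {d : ℕ} {v : V} (hv : v ∈ 𝒱.weight d) (k : ℤ) {n : ℕ} {α : ℂ}
    {x : A} (hx : x ∈ MA.refinedLevel n α) :
    MA.Y v k x = 0 ∨ ∃ m : ℕ, MA.Y v k x ∈ MA.refinedLevel m α := by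
  obtain ⟨h1, h2⟩ := MA.mode_level d v hv k n x hx.1
  rcases lt_or_ge ((n : ℤ) + d - k - 1) 0 with h | h
  · exact Or.inl (h2 h)
  · obtain ⟨m, hm⟩ := Int.eq_ofNat_of_zero_le h
    refine Or.inr ⟨m, h1 m hm.symm, Module.End.mem_eigenspace_iff.2 ?_⟩
    rw [MA.L_zero_mode hv, Module.End.mem_eigenspace_iff.1 hx.2,
      map_smul, ← add_smul]
    congr 1
    have : ((m : ℤ) : ℂ) = ((n : ℤ) + d - k - 1 : ℤ) := by rw [hm]
    push_cast at this
    rw [this]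
    ring

/-- A unitary module is spanned by its homogeneous vectors of non-negative top weight: this holds at
level zero, and modes preserve the top weight. -/
theorem IsUnitary.iSup_refinedLevel (hA : MA.IsUnitary U) :
    ⨆ i : ℕ × MA.nonnegTopWeights, MA.refinedLevel i.1 i.2 = ⊤ := by
  refine MA.top_generates _ ?_ fun v k a ha => ?_
  · refine (MA.level_weights 0).trans (iSup₂_le fun α hα x hx => ?_)
    by_cases hx0 : x = 0
    · exact hx0 ▸ zero_mem _
    · exact Submodule.mem_iSup_of_mem
        (p := fun i : ℕ × MA.nonnegTopWeights => MA.refinedLevel i.1 i.2)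
        ⟨0, α, hα, hA.exists_nonneg_of_mem_zero hx hx0⟩ hx
  · refine VOA.induction_weight (𝒱 := 𝒱)
      (p := fun v => MA.Y v k a ∈ ⨆ i : ℕ × MA.nonnegTopWeights, MA.refinedLevel i.1 i.2)
      (by simp) (fun u v hu hv => by simpa using add_mem hu hv) (fun d v hv => ?_) v
    refine Submodule.iSup_induction _ (motive := fun a => MA.Y v k a ∈
      ⨆ i : ℕ × MA.nonnegTopWeights, MA.refinedLevel i.1 i.2) ha ?_ (by simp)
      fun x y hx hy => by simpa using add_mem hx hy
    rintro ⟨n, α⟩ x hx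
    rcases MA.mode_mem_refinedLevel hv k hx with h | ⟨m, hm⟩
    · rw [h]
      exact zero_mem _
    · exact Submodule.mem_iSup_of_mem
        (p := fun i : ℕ × MA.nonnegTopWeights => MA.refinedLevel i.1 i.2) (m, α) hm

theorem IsUnitary.induction_refined (hA : MA.IsUnitary U) {p : A → Prop} (h0 : p 0)
    (hadd : ∀ x y, p x → p y → p (x + y))
    (hom : ∀ n, ∀ α ∈ MA.nonnegTopWeights, ∀ x ∈ MA.refinedLevel n α, p x) (x : A) : p x :=
  Submodule.iSup_induction _ (motive := p)
    (hA.iSup_refinedLevel ▸ Submodule.mem_top :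
      x ∈ ⨆ i : ℕ × MA.nonnegTopWeights, MA.refinedLevel i.1 i.2)
    (fun i x hx => hom i.1 i.2 i.2.2 x hx) h0 hadd

theorem IsUnitary.orthogonalFamily_refined (hA : MA.IsUnitary U) :
    OrthogonalFamily ℂ (fun i : ℕ × MA.nonnegTopWeights => MA.refinedLevel i.1 i.2)
      fun i => (MA.refinedLevel i.1 i.2).subtypeₗᵢ := by
  rintro ⟨n, α⟩ ⟨k, β⟩ hne ⟨x, hx⟩ ⟨y, hy⟩
  by_cases hnk : n = k
  · subst hnk
    exact hA.inner_weight (fun h => hne (Prod.ext rfl (Subtype.ext (add_right_cancel h)))) hx.2 hy.2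
  · exact hA.inner_level hnk hx.1 hy.1

theorem IsUnitary.level_le_iSup (hA : MA.IsUnitary U) (n : ℕ) :
    MA.level n ≤ ⨆ α : MA.nonnegTopWeights, MA.refinedLevel n α := by
  intro x hx
  rw [← MA.mem_level_iff.1 hx]
  refine hA.induction_refined (p := fun x => MA.levelProj n x ∈
    ⨆ α : MA.nonnegTopWeights, MA.refinedLevel n α) (by simp)
    (fun x y hx hy => by simpa using add_mem hx hy) (fun k α hα y hy => ?_) x
  rw [MA.levelProj_of_mem hy.1]
  split_ifs with h
  · rw [Nat.cast_inj] at h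
    subst h
    exact Submodule.mem_iSup_of_mem (p := fun α : MA.nonnegTopWeights => MA.refinedLevel k α)
      ⟨α, hα⟩ hy
  · exact zero_mem _

/-! ### The operators `q ^ (L₀ / 2)` and the level projections -/

theorem levelProj_qHalfL0 (hA : MA.IsUnitary U) (q : ℝ) (l : ℤ) (x : A) :
    MA.levelProj l (MA.qHalfL0 q x) = MA.qHalfL0 q (MA.levelProj l x) := by
  refine hA.induction_refined (p := fun x => MA.levelProj l (MA.qHalfL0 q x)
    = MA.qHalfL0 q (MA.levelProj l x)) (by simp)
    (fun x y hx hy => by simp only [map_add, hx, hy]) (fun n α hα x hx => ?_) x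
  rw [MA.qHalfL0_of_mem hx.2, map_smul, MA.levelProj_of_mem hx.1]
  split_ifs
  · rw [MA.qHalfL0_of_mem hx.2]
  · simp

theorem qHalfL0_mem_level (hA : MA.IsUnitary U) (q : ℝ) {n : ℕ} {x : A} (hx : x ∈ MA.level n) :
    MA.qHalfL0 q x ∈ MA.level n := by
  rw [mem_level_iff] at hx ⊢
  rw [levelProj_qHalfL0 hA, hx]

theorem qHalfL0_mul (hA : MA.IsUnitary U) {q₁ q₂ : ℝ} (h₁ : 0 ≤ q₁) (h₂ : 0 ≤ q₂) (x : A) :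
    MA.qHalfL0 (q₁ * q₂) x = MA.qHalfL0 q₁ (MA.qHalfL0 q₂ x) := by
  refine hA.induction_refined (p := fun x => MA.qHalfL0 (q₁ * q₂) x
    = MA.qHalfL0 q₁ (MA.qHalfL0 q₂ x)) (by simp)
    (fun x y hx hy => by simp only [map_add, hx, hy]) (fun n α hα x hx => ?_) x
  rw [MA.qHalfL0_of_mem hx.2, MA.qHalfL0_of_mem hx.2, map_smul, MA.qHalfL0_of_mem hx.2,
    smul_smul, Complex.ofReal_mul, Complex.mul_cpow_ofReal_nonneg h₁ h₂, mul_comm]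

theorem norm_cpow_weight_le {q : ℝ} (h0 : 0 < q) (h1 : q < 1) (n : ℕ) {α : ℂ}
    (hα : α ∈ MA.nonnegTopWeights) : ‖(q : ℂ) ^ ((α + n) / 2)‖ ≤ q ^ ((n : ℝ) / 2) := by
  obtain ⟨-, r, hr, rfl⟩ := hα
  rw [Complex.norm_cpow_eq_rpow_re_of_pos h0]
  refine Real.rpow_le_rpow_of_exponent_ge h0 h1.le ?_
  have : (((r : ℂ) + n) / 2).re = (r + n) / 2 := by
    rw [show ((r : ℂ) + n) / 2 = (((r + n) / 2 : ℝ) : ℂ) by push_cast; rfl, Complex.ofReal_re]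
  rw [this]
  linarith

theorem norm_qHalfL0_level_le (hA : MA.IsUnitary U) {q : ℝ} (h0 : 0 < q) (h1 : q < 1) {n : ℕ}
    {x : A} (hx : x ∈ MA.level n) : ‖MA.qHalfL0 q x‖ ≤ q ^ ((n : ℝ) / 2) * ‖x‖ :=
  norm_diagonal_le (G := fun α : MA.nonnegTopWeights => MA.refinedLevel n α)
    (hA.orthogonalFamily_refined.comp (γ := MA.nonnegTopWeights) (f := fun α => (n, α))
      fun _ _ h => (Prod.mk.inj h).2)
    (fun _ _ hx => MA.qHalfL0_of_mem hx.2 q) (fun α => norm_cpow_weight_le h0 h1 n α.2)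
    (by positivity) (hA.level_le_iSup n hx)

theorem norm_qHalfL0_le (hA : MA.IsUnitary U) {q : ℝ} (h0 : 0 < q) (h1 : q < 1) (x : A) :
    ‖MA.qHalfL0 q x‖ ≤ ‖x‖ := by
  have := norm_diagonal_le hA.orthogonalFamily_refined
    (fun _ _ hx => MA.qHalfL0_of_mem hx.2 q) (M := 1)
    (fun i => (norm_cpow_weight_le h0 h1 i.1 i.2.2).trans
      (Real.rpow_le_one h0.le h1.le (by positivity))) zero_le_one
    (x := x) (hA.iSup_refinedLevel ▸ Submodule.mem_top)
  simpa using this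

theorem norm_levelProj_le (hA : MA.IsUnitary U) (l : ℤ) (x : A) : ‖MA.levelProj l x‖ ≤ ‖x‖ := by
  have := norm_diagonal_le hA.orthogonalFamily_level (D := MA.levelProj l)
    (c := fun n => if (n : ℤ) = l then 1 else 0)
    (fun n x hx => by rw [MA.levelProj_of_mem hx]; split_ifs <;> simp) (M := 1)
    (fun i => by split_ifs <;> simp) zero_le_one
    (x := x) (MA.level_internal.submodule_iSup_eq_top ▸ Submodule.mem_top)
  simpa using this

theorem inner_qHalfL0 (hA : MA.IsUnitary U) {q : ℝ} (h0 : 0 < q) (x y : A) :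
    ⟪MA.qHalfL0 q x, y⟫_ℂ = ⟪x, MA.qHalfL0 q y⟫_ℂ := by
  refine hA.induction_refined (p := fun x => ⟪MA.qHalfL0 q x, y⟫_ℂ = ⟪x, MA.qHalfL0 q y⟫_ℂ)
    (by simp) (fun x y hx hy => by simp only [map_add, inner_add_left, hx, hy])
    (fun n α hα x hx => ?_) x
  refine hA.induction_refined (p := fun y => ⟪MA.qHalfL0 q x, y⟫_ℂ = ⟪x, MA.qHalfL0 q y⟫_ℂ)
    (by simp) (fun x y hx hy => by simp only [map_add, inner_add_right, hx, hy])
    (fun k β hβ y hy => ?_) y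
  rw [MA.qHalfL0_of_mem hx.2, MA.qHalfL0_of_mem hy.2, inner_smul_left, inner_smul_right]
  by_cases hw : α + n = β + k
  · rw [← hw]
    congr 1
    obtain ⟨-, r, hr, rfl⟩ := hα
    rw [show ((r : ℂ) + n) / 2 = (((r + n) / 2 : ℝ) : ℂ) by push_cast; rfl,
      ← Complex.ofReal_cpow h0.le, Complex.conj_ofReal]
  · rw [hA.inner_weight hw hx.2 hy.2, mul_zero, mul_zero]

theorem inner_levelProj (hA : MA.IsUnitary U) {n : ℕ} {x : A} (hx : x ∈ MA.level n) (l : ℤ)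
    (y : A) : ⟪x, MA.levelProj l y⟫_ℂ = if (n : ℤ) = l then ⟪x, y⟫_ℂ else 0 := by
  refine MA.induction_level (p := fun y => ⟪x, MA.levelProj l y⟫_ℂ
    = if (n : ℤ) = l then ⟪x, y⟫_ℂ else 0) (by simp)
    (fun y z hy hz => by rw [map_add, inner_add_right, hy, hz]; split_ifs <;> simp)
    (fun k y hy => ?_) y
  rw [MA.levelProj_of_mem hy]
  by_cases hnk : n = k
  · subst hnk
    split_ifs <;> simp
  · rw [hA.inner_level hnk hx hy]
    split_ifs <;> first | exact hA.inner_level hnk hx hy | simp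

theorem inner_weightProj (hA : MA.IsUnitary U) {w : ℂ} {x : A}
    (hx : x ∈ Module.End.eigenspace (MA.L 0) w) (y : A) :
    ⟪x, MA.weightProj w y⟫_ℂ = ⟪x, y⟫_ℂ := by
  refine hA.induction_refined (p := fun y => ⟪x, MA.weightProj w y⟫_ℂ = ⟪x, y⟫_ℂ) (by simp)
    (fun y z hy hz => by rw [map_add, inner_add_right, hy, hz, inner_add_right])
    (fun k β hβ y hy => ?_) y
  rw [MA.weightProj_of_mem hy.2]
  split_ifs with h
  · rfl
  · rw [hA.inner_weight (Ne.symm h) hx hy.2, inner_zero_right]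

theorem sum_norm_levelProj_sq (hA : MA.IsUnitary U) (F : Finset ℕ) (x : A)
    (hF : ∑ n ∈ F, MA.levelProj n x = x) : ∑ n ∈ F, ‖MA.levelProj n x‖ ^ 2 = ‖x‖ ^ 2 := by
  rw [← norm_sq_sum_of_orthogonal hA.orthogonalFamily_level F (fun n => MA.levelProj n x)
    fun n => MA.levelProj_mem n x, hF]

/-- The vectors `q ^ (L₀ / 2) a` with `a ∈ S_hom` remain in `S_hom`. -/
theorem qHalfL0_mem_homPart {S : Submodule ℂ A} (q : ℝ) {a : A} (ha : a ∈ MA.homPart S) :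
    MA.qHalfL0 q a ∈ MA.homPart S := by
  have : MA.homPart S ≤ (MA.homPart S).comap (MA.qHalfL0 q) := by
    refine iSup_le fun n => iSup₂_le fun α hα x hx => ?_
    rw [Submodule.mem_comap, MA.qHalfL0_of_mem hx.2.2]
    exact Submodule.smul_mem _ _ (Submodule.mem_iSup_of_mem n
      (Submodule.mem_iSup_of_mem α (Submodule.mem_iSup_of_mem hα hx)))
  exact this ha

theorem homPart_le (S : Submodule ℂ A) : MA.homPart S ≤ S :=
  iSup_le fun _ => iSup₂_le fun _ _ => inf_le_left

theorem induction_homPart {S : Submodule ℂ A} {p : A → Prop} (h0 : p 0)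
    (hadd : ∀ x y, p x → p y → p (x + y))
    (hom : ∀ n, ∀ α ∈ MA.topWeights, ∀ x ∈ S ⊓ MA.refinedLevel n α, p x) {a : A}
    (ha : a ∈ MA.homPart S) : p a :=
  Submodule.iSup_induction _ (motive := p) ha (fun n _ hx =>
    Submodule.iSup_induction _ (motive := p) hx (fun α _ hy =>
      Submodule.iSup_induction _ (motive := p) hy (fun hα z hz => hom n α hα z hz) h0 hadd)
      h0 hadd) h0 hadd

theorem L_zero_levelProj (hA : MA.IsUnitary U) (l : ℤ) (x : A) :
    MA.L 0 (MA.levelProj l x) = MA.levelProj l (MA.L 0 x) := by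
  refine hA.induction_refined (p := fun x => MA.L 0 (MA.levelProj l x)
    = MA.levelProj l (MA.L 0 x)) (by simp)
    (fun x y hx hy => by simp only [map_add, hx, hy]) (fun n α hα x hx => ?_) x
  rw [Module.End.mem_eigenspace_iff.1 hx.2, map_smul, MA.levelProj_of_mem hx.1]
  split_ifs
  · exact Module.End.mem_eigenspace_iff.1 hx.2
  · simp

theorem levelProj_eq_zero_of_weight (hA : MA.IsUnitary U) {l : ℤ} {w : ℂ} {x : A}
    (hx : x ∈ Module.End.eigenspace (MA.L 0) w) (h : ∀ α ∈ MA.topWeights, α + l ≠ w) :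
    MA.levelProj l x = 0 := by
  rcases lt_or_ge l 0 with hl | hl
  · rw [MA.levelProj_of_neg hl, LinearMap.zero_apply]
  · lift l to ℕ using hl
    have hw : MA.levelProj l x ∈ Module.End.eigenspace (MA.L 0) w := by
      rw [Module.End.mem_eigenspace_iff] at hx ⊢
      rw [L_zero_levelProj hA, hx, map_smul]
    have key : ∀ y ∈ MA.level l, ⟪MA.levelProj l x, y⟫_ℂ = 0 := by
      intro y hy
      refine Submodule.iSup_induction _ (motive := fun y => ⟪MA.levelProj l x, y⟫_ℂ = 0)
        (hA.level_le_iSup l hy) (fun α y hy => ?_) (inner_zero_right _) fun y z hy hz => by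
          rw [inner_add_right, hy, hz, add_zero]
      exact hA.inner_weight (Ne.symm (by simpa using h α α.2.1)) hw hy.2
    exact inner_self_eq_zero.1 (key _ (MA.levelProj_mem l x))

end VOAModule

/-! ### Weights and levels of the modes of an intertwiner -/

namespace Intertwiner

variable {V A B C : Type*} [NormedAddCommGroup V] [InnerProductSpace ℂ V] {𝒱 : VOA V}
  {U : UnitaryStructure 𝒱}
  [NormedAddCommGroup A] [InnerProductSpace ℂ A] [NormedAddCommGroup B] [InnerProductSpace ℂ B]
  [NormedAddCommGroup C] [InnerProductSpace ℂ C]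
  {MA : VOAModule 𝒱 A} {MB : VOAModule 𝒱 B} {MC : VOAModule 𝒱 C} (𝒴 : Intertwiner MA MB MC)

theorem coeff_mem_weight {wa wb : ℂ} {a : A} {b : B}
    (ha : a ∈ Module.End.eigenspace (MA.L 0) wa) (hb : b ∈ Module.End.eigenspace (MB.L 0) wb)
    (s : ℂ) : 𝒴.coeff s a b ∈ Module.End.eigenspace (MC.L 0) (wa + wb - s) := by
  have h := 𝒴.jacobi 𝒱.ω a b 0 1 s
  rw [finsum_choose_one_smul, finsum_choose_zero_smul] at h
  have ht := 𝒴.translation a (s + 1)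
  rw [Module.End.mem_eigenspace_iff] at ha hb ⊢
  simp only [VOAModule.L] at ha hb ht ⊢
  norm_num at ha hb ht h ⊢
  rw [ha, hb, ht, map_smul, map_smul] at h
  rw [sub_eq_iff_eq_add.1 h.symm]
  simp only [LinearMap.neg_apply, LinearMap.smul_apply]
  module

/-- The part of the coefficient of `z ^ (-s)` that lowers levels by `m` vanishes unless
`s - m - n` is one of the exponents `α + β - γ`. -/
theorem levelProj_coeff_eq_zero (hA : MA.IsUnitary U) (hB : MB.IsUnitary U) (hC : MC.IsUnitary U)
    {n k : ℕ} {a : A} {b : B} (ha : a ∈ MA.level n) (hb : b ∈ MB.level k) {s : ℂ} {m : ℤ}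
    (h : s - m - n ∉ 𝒴.exponentSet) : MC.levelProj (k - m) (𝒴.coeff s a b) = 0 := by
  refine Submodule.iSup_induction _
    (motive := fun a => MC.levelProj (k - m) (𝒴.coeff s a b) = 0)
    (hA.level_le_iSup n ha) (fun α a ha => ?_) (by simp)
    (fun x y hx hy => by simp only [map_add, LinearMap.add_apply, hx, hy, add_zero])
  refine Submodule.iSup_induction _
    (motive := fun b => MC.levelProj (k - m) (𝒴.coeff s a b) = 0)
    (hB.level_le_iSup k hb) (fun β b hb => ?_) (by simp)
    (fun x y hx hy => by simp only [map_add, hx, hy, add_zero])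
  refine VOAModule.levelProj_eq_zero_of_weight hC (𝒴.coeff_mem_weight ha.2 hb.2 s)
    fun γ hγ hw => h ?_
  refine Finset.mem_image.2 ⟨(α, β, γ), by simp [α.2.1, β.2.1, hγ], ?_⟩
  push_cast at hw
  linear_combination -hw

theorem mode_of_mem (τ : ℂ) (m : ℤ) (n : ℕ) (a : A) {k : ℕ} {b : B} (hb : b ∈ MB.level k) :
    𝒴.mode τ m n a b = MC.levelProj (k - m) (𝒴.coeff (m + τ + n) a b) := by
  rw [mode, gradedSum_of_mem _ _ _ hb]
  rfl

theorem mode_zero (τ : ℂ) (m : ℤ) (n : ℕ) : 𝒴.mode τ m n 0 = 0 := by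
  ext b
  refine MB.induction_level (p := fun b => 𝒴.mode τ m n 0 b = 0) (map_zero _)
    (fun x y hx hy => by rw [map_add, hx, hy, add_zero]) (fun k b hb => ?_) b
  rw [mode_of_mem 𝒴 _ _ _ _ hb]
  simp

/-- On level `k`, truncation keeps the components of levels `k - m` with `|m| ≤ N`; each pair of
`m` and the exponent of `z` determines at most one `τ`. -/
theorem truncated_apply (hA : MA.IsUnitary U) (hB : MB.IsUnitary U) (hC : MC.IsUnitary U)
    (N : ℝ) (a : A) (s : ℂ) {k : ℕ} {b : B} (hb : b ∈ MB.level k) :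
    𝒴.truncated N a s b
      = ∑ m ∈ Finset.Icc (-⌊N⌋) ⌊N⌋, MC.levelProj (k - m) (𝒴.coeff s a b) := by
  obtain ⟨F, hF0, hF⟩ := MA.exists_sum_levelProj a
  have key : ∀ n : ℕ, (∑ τ ∈ 𝒴.exponentSet, ∑ m ∈ Finset.Icc (-⌊N⌋) ⌊N⌋,
      if s = m + τ + n then 𝒴.mode τ m n (MA.levelProj n a) else 0) b
      = ∑ m ∈ Finset.Icc (-⌊N⌋) ⌊N⌋, MC.levelProj (k - m) (𝒴.coeff s (MA.levelProj n a) b) := by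
    intro n
    rw [Finset.sum_comm, LinearMap.sum_apply]
    refine Finset.sum_congr rfl fun m _ => ?_
    rw [LinearMap.sum_apply]
    have : ∀ τ ∈ 𝒴.exponentSet,
        (if s = m + τ + n then 𝒴.mode τ m n (MA.levelProj n a) else 0) b
        = if τ = s - m - n then MC.levelProj (k - m) (𝒴.coeff s (MA.levelProj n a) b) else 0 := by
      intro τ _
      by_cases h : s = m + τ + n
      · rw [if_pos h, if_pos (by rw [h]; ring), mode_of_mem 𝒴 _ _ _ _ hb, ← h]
      · rw [if_neg h, if_neg (fun h' => h (by rw [h']; ring)), LinearMap.zero_apply]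
    rw [Finset.sum_congr rfl this, Finset.sum_ite_eq']
    split_ifs with h
    · rfl
    · exact (𝒴.levelProj_coeff_eq_zero hA hB hC (MA.levelProj_mem n a) hb h).symm
  rw [truncated, finsum_eq_sum_of_support_subset (s := F), LinearMap.sum_apply,
    Finset.sum_congr rfl fun n _ => key n, Finset.sum_comm]
  · refine Finset.sum_congr rfl fun m _ => ?_
    rw [← map_sum, ← LinearMap.sum_apply, ← map_sum, hF]
  · intro n hn
    contrapose! hn
    simp [hF0 n (by simpa using hn), mode_zero]

/-! ### The scaled intertwiner -/

theorem scaled_add_left (q : ℝ) (a a' : A) (s : ℂ) (b : B) :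
    𝒴.scaled q (a + a') s b = 𝒴.scaled q a s b + 𝒴.scaled q a' s b := by
  simp [scaled]

theorem scaled_zero_left (q : ℝ) (s : ℂ) (b : B) : 𝒴.scaled q 0 s b = 0 := by
  simp [scaled]

theorem scaled_mem_weight {wa wb : ℂ} {a : A} {b : B}
    (ha : a ∈ Module.End.eigenspace (MA.L 0) wa) (hb : b ∈ Module.End.eigenspace (MB.L 0) wb)
    (q : ℝ) (s : ℂ) : 𝒴.scaled q a s b ∈ Module.End.eigenspace (MC.L 0) (wa + wb - s) := by
  have h := 𝒴.coeff_mem_weight ha hb s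
  simp only [scaled, LinearMap.comp_apply]
  rw [MA.qHalfL0_of_mem ha, MB.qHalfL0_of_mem hb]
  simp only [map_smul, LinearMap.smul_apply, MC.qHalfL0_of_mem h]
  exact Submodule.smul_mem _ _ (Submodule.smul_mem _ _ (Submodule.smul_mem _ _ h))

theorem scaled_mul (hA : MA.IsUnitary U) (hB : MB.IsUnitary U) (hC : MC.IsUnitary U)
    {q₁ q₂ : ℝ} (h₁ : 0 ≤ q₁) (h₂ : 0 ≤ q₂) (a : A) (s : ℂ) (b : B) :
    𝒴.scaled (q₁ * q₂) a s b
      = MC.qHalfL0 q₁ (𝒴.scaled q₂ (MA.qHalfL0 q₁ a) s (MB.qHalfL0 q₁ b)) := by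
  simp only [scaled, LinearMap.comp_apply]
  rw [VOAModule.qHalfL0_mul hC h₁ h₂, mul_comm, VOAModule.qHalfL0_mul hA h₂ h₁,
    VOAModule.qHalfL0_mul hB h₂ h₁]

theorem scaledTruncated_apply (hA : MA.IsUnitary U) (hB : MB.IsUnitary U) (hC : MC.IsUnitary U)
    (N q : ℝ) (a : A) (s : ℂ) {k : ℕ} {b : B} (hb : b ∈ MB.level k) :
    𝒴.scaledTruncated N q a s b
      = ∑ m ∈ Finset.Icc (-⌊N⌋) ⌊N⌋, MC.levelProj (k - m) (𝒴.scaled q a s b) := by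
  simp only [scaledTruncated, scaled, LinearMap.comp_apply]
  rw [𝒴.truncated_apply hA hB hC N _ s (VOAModule.qHalfL0_mem_level hB q hb), map_sum]
  exact Finset.sum_congr rfl fun m _ => (VOAModule.levelProj_qHalfL0 hC q _ _).symm

theorem exists_finset_weightProj_scaled (hA : MA.IsUnitary U) (hB : MB.IsUnitary U)
    (q : ℝ) (w : ℂ) (a : A) (b : B) :
    ∃ F : Finset ℂ, ∀ s ∉ F, MC.weightProj w (𝒴.scaled q a s b) = 0 := by
  classical
  refine hA.induction_refined (p := fun a => ∃ F : Finset ℂ, ∀ s ∉ F,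
    MC.weightProj w (𝒴.scaled q a s b) = 0) ⟨∅, by simp [scaled_zero_left]⟩ ?_
    (fun n α _ a ha => ?_) a
  · rintro x y ⟨F, hF⟩ ⟨G, hG⟩
    refine ⟨F ∪ G, fun s hs => ?_⟩
    rw [Finset.notMem_union] at hs
    rw [scaled_add_left, map_add, hF s hs.1, hG s hs.2, add_zero]
  refine hB.induction_refined (p := fun b => ∃ F : Finset ℂ, ∀ s ∉ F,
    MC.weightProj w (𝒴.scaled q a s b) = 0) ⟨∅, by simp⟩ ?_ (fun k β _ b hb => ?_) b
  · rintro x y ⟨F, hF⟩ ⟨G, hG⟩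
    refine ⟨F ∪ G, fun s hs => ?_⟩
    rw [Finset.notMem_union] at hs
    rw [map_add, map_add, hF s hs.1, hG s hs.2, add_zero]
  · refine ⟨{α + n + (β + k) - w}, fun s hs => ?_⟩
    rw [MC.weightProj_of_mem (𝒴.scaled_mem_weight ha.2 hb.2 q s), if_neg]
    rintro rfl
    exact hs (by simp)

end Intertwiner

/-! ### Series of linear maps at a complex number -/

section Series

variable {B C : Type*} [NormedAddCommGroup B] [InnerProductSpace ℂ B]
  [NormedAddCommGroup C] [InnerProductSpace ℂ C]

/-- The term `z ^ (-s) F_s b` of the series `F(z) b`, in the Hilbert space completion. -/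
noncomputable def seriesTerm (lg : ℂ → ℂ) (F : ℂ → B →ₗ[ℂ] C) (z : ℂ) (b : B) (s : ℂ) :
    UniformSpace.Completion C :=
  ((Complex.exp (-s * lg z) • F s b : C) : UniformSpace.Completion C)

variable {lg : ℂ → ℂ} {F G : ℂ → B →ₗ[ℂ] C} {z : ℂ}

theorem seriesTerm_add (b b' : B) :
    seriesTerm lg F z (b + b') = seriesTerm lg F z b + seriesTerm lg F z b' := by
  ext s
  simp [seriesTerm, UniformSpace.Completion.coe_add]

theorem seriesTerm_smul (c : ℂ) (b : B) :
    seriesTerm lg F z (c • b) = c • seriesTerm lg F z b := by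
  ext s
  simp [seriesTerm, ← UniformSpace.Completion.coe_smul, smul_comm c]

/-- The sum `b ↦ F(z) b` of an everywhere convergent series. -/
noncomputable def seriesMap (hF : ∀ b, Summable (seriesTerm lg F z b)) :
    B →ₗ[ℂ] UniformSpace.Completion C where
  toFun b := ∑' s, seriesTerm lg F z b s
  map_add' b b' := by
    rw [seriesTerm_add, ← (hF b).tsum_add (hF b')]
    rfl
  map_smul' c b := by
    rw [seriesTerm_smul, RingHom.id_apply, ← (hF b).tsum_const_smul c]
    rfl

theorem hasSum_seriesMap (hF : ∀ b, Summable (seriesTerm lg F z b)) (b : B) :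
    HasSum (seriesTerm lg F z b) (seriesMap hF b) := (hF b).hasSum

theorem hasSum_inner_seriesMap (hF : ∀ b, Summable (seriesTerm lg F z b)) (b : B) (c : C) :
    HasSum (fun s => Complex.exp (-s * lg z) * ⟪c, F s b⟫_ℂ)
      ⟪(c : UniformSpace.Completion C), seriesMap hF b⟫_ℂ := by
  have h := (hasSum_seriesMap hF b).mapL (innerSL ℂ (c : UniformSpace.Completion C))
  simpa [seriesTerm, inner_smul_right] using h

theorem exists_isValueAt (hF : ∀ b, Summable (seriesTerm lg F z b)) {M : ℝ}
    (hM : ∀ b, ‖seriesMap hF b‖ ≤ M * ‖b‖) :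
    ∃ W : UniformSpace.Completion B →L[ℂ] UniformSpace.Completion C, IsValueAt lg F z W := by
  refine ⟨((seriesMap hF).mkContinuous M hM).fromCompletion, fun b => ?_⟩
  rw [ContinuousLinearMap.fromCompletion_apply_coe]
  exact hasSum_seriesMap hF b

theorem norm_sub_le_of_isValueAt (hF : ∀ b, Summable (seriesTerm lg F z b))
    (hG : ∀ b, Summable (seriesTerm lg G z b))
    {W X : UniformSpace.Completion B →L[ℂ] UniformSpace.Completion C}
    (hW : IsValueAt lg F z W) (hX : IsValueAt lg G z X) {M : ℝ} (hM0 : 0 ≤ M)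
    (hM : ∀ b, ‖seriesMap hF b - seriesMap hG b‖ ≤ M * ‖b‖) : ‖W - X‖ ≤ M := by
  refine ContinuousLinearMap.opNorm_le_bound _ hM0 fun x => ?_
  induction x using UniformSpace.Completion.induction_on with
  | hp => exact isClosed_le (by fun_prop) (by fun_prop)
  | ih b =>
    have h := hM b
    rw [(hasSum_seriesMap hF b).unique (hW b), (hasSum_seriesMap hG b).unique (hX b)] at h
    simpa using h

end Series

/-! ### Geometric sums off the diagonal -/

theorem sum_geometric_gt_le {q : ℝ} (h0 : 0 < q) (h1 : q < 1) (N : ℝ) (F : Finset ℕ) :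
    ∑ k ∈ F, (if N < k then q ^ k else 0) ≤ q ^ N / (1 - q) := by
  rw [← Finset.sum_filter]
  have hsub : F.filter (fun k : ℕ => N < k) ⊆ Finset.Ico ⌈N⌉₊ (F.sup id + 1) := by
    intro k hk
    rw [Finset.mem_filter] at hk
    rw [Finset.mem_Ico, Nat.lt_succ_iff]
    exact ⟨Nat.ceil_le.2 hk.2.le, Finset.le_sup (f := id) hk.1⟩
  calc ∑ k ∈ F.filter (fun k : ℕ => N < k), q ^ k
      ≤ ∑ k ∈ Finset.Ico ⌈N⌉₊ (F.sup id + 1), q ^ k :=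
        Finset.sum_le_sum_of_subset_of_nonneg hsub fun _ _ _ => by positivity
    _ ≤ q ^ ⌈N⌉₊ / (1 - q) := geom_sum_Ico_le_of_lt_one h0.le h1
    _ ≤ q ^ N / (1 - q) := by
        have : 0 < 1 - q := by linarith
        gcongr
        rw [← Real.rpow_natCast]
        exact Real.rpow_le_rpow_of_exponent_ge h0 h1.le (Nat.le_ceil N)

theorem sum_geometric_le {q : ℝ} (h0 : 0 < q) (h1 : q < 1) (F : Finset ℕ) :
    ∑ k ∈ F, q ^ k ≤ 1 / (1 - q) := by
  have := (summable_geometric_of_lt_one h0.le h1).sum_le_tsum F fun _ _ => by positivity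
  rwa [tsum_geometric_of_lt_one h0.le h1, ← one_div] at this

/-- If `|k - l| > N` then `k > N` or `l > N`, so the double geometric sum over such pairs is at most
twice a product of two geometric series. -/
theorem sum_geometric_offDiagonal_le {q : ℝ} (h0 : 0 < q) (h1 : q < 1) (N : ℝ) (F G : Finset ℕ) :
    ∑ l ∈ F, ∑ k ∈ G, (if (k : ℤ) - l ∈ Finset.Icc (-⌊N⌋) ⌊N⌋ then 0 else q ^ l * q ^ k)
      ≤ 2 * (q ^ N / (1 - q) ^ 2) := by
  have hq : 0 < 1 - q := by linarith
  have key : ∀ l k : ℕ, (if (k : ℤ) - l ∈ Finset.Icc (-⌊N⌋) ⌊N⌋ then 0 else q ^ l * q ^ k)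
      ≤ q ^ l * (if N < k then q ^ k else 0) + (if N < l then q ^ l else 0) * q ^ k := by
    intro l k
    have hk : 0 ≤ if N < k then q ^ k else 0 := by split_ifs <;> positivity
    have hl : 0 ≤ if N < l then q ^ l else 0 := by split_ifs <;> positivity
    by_cases h : (k : ℤ) - l ∈ Finset.Icc (-⌊N⌋) ⌊N⌋
    · rw [if_pos h]
      positivity
    rw [if_neg h]
    by_cases h2 : N < k
    · rw [if_pos h2]
      exact le_add_of_nonneg_right (by positivity)
    by_cases h3 : N < l
    · rw [if_pos h3]
      exact le_add_of_nonneg_left (by positivity)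
    exfalso
    apply h
    rw [not_lt] at h2 h3
    have h2' : (k : ℤ) ≤ ⌊N⌋ := Int.le_floor.2 (by exact_mod_cast h2)
    have h3' : (l : ℤ) ≤ ⌊N⌋ := Int.le_floor.2 (by exact_mod_cast h3)
    rw [Finset.mem_Icc]
    omega
  calc _ ≤ ∑ l ∈ F, ∑ k ∈ G, (q ^ l * (if N < k then q ^ k else 0)
        + (if N < l then q ^ l else 0) * q ^ k) :=
        Finset.sum_le_sum fun l _ => Finset.sum_le_sum fun k _ => key l k
    _ = (∑ l ∈ F, q ^ l) * (∑ k ∈ G, if N < k then q ^ k else 0)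
        + (∑ l ∈ F, if N < l then q ^ l else 0) * ∑ k ∈ G, q ^ k := by
        simp only [Finset.sum_add_distrib, Finset.sum_mul_sum]
    _ ≤ 1 / (1 - q) * (q ^ N / (1 - q)) + q ^ N / (1 - q) * (1 / (1 - q)) := by
        refine add_le_add (mul_le_mul (sum_geometric_le h0 h1 F) (sum_geometric_gt_le h0 h1 N G)
          (Finset.sum_nonneg fun k _ => ?_) (by positivity))
          (mul_le_mul (sum_geometric_gt_le h0 h1 N F) (sum_geometric_le h0 h1 G)
          (Finset.sum_nonneg fun k _ => ?_) (by positivity))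
        · split_ifs <;> positivity
        · positivity
    _ = 2 * (q ^ N / (1 - q) ^ 2) := by
        field_simp
        ring

namespace Intertwiner

variable {V A B C : Type*} [NormedAddCommGroup V] [InnerProductSpace ℂ V] {𝒱 : VOA V}
  {U : UnitaryStructure 𝒱}
  [NormedAddCommGroup A] [InnerProductSpace ℂ A] [NormedAddCommGroup B] [InnerProductSpace ℂ B]
  [NormedAddCommGroup C] [InnerProductSpace ℂ C]
  {MA : VOAModule 𝒱 A} {MB : VOAModule 𝒱 B} {MC : VOAModule 𝒱 C} (𝒴 : Intertwiner MA MB MC)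

/-! ### Convergence of the scaled intertwiner -/

/-- For vectors `a`, `b` of weights `wa`, `wb` the terms of `W_q(a,z) b` lie in the distinct weight
spaces of weights `wa + wb - s`, so a finite value of the form makes the series converge. -/
theorem summable_scaled_of_weight (hC : MC.IsUnitary U) {lg : ℂ → ℂ} {q : ℝ} {z : ℂ}
    {wa wb : ℂ} {a : A} {b : B} (ha : a ∈ Module.End.eigenspace (MA.L 0) wa)
    (hb : b ∈ Module.End.eigenspace (MB.L 0) wb) (h : 𝒴.form lg q z a b ≠ ∞) :
    Summable (seriesTerm lg (𝒴.scaled q a) z b) := by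
  have hmem : ∀ w, 𝒴.scaled q a (wa + wb - w) b ∈ Module.End.eigenspace (MC.L 0) w := fun w => by
    simpa using 𝒴.scaled_mem_weight ha hb q (wa + wb - w)
  let f : ∀ w : ℂ, Module.End.eigenspace (MC.L 0) w := fun w =>
    ⟨Complex.exp (-(wa + wb - w) * lg z) • 𝒴.scaled q a (wa + wb - w) b,
      Submodule.smul_mem _ _ (hmem w)⟩
  have hform : 𝒴.form lg q z a b = ∑' w : ℂ, ‖f w‖ₑ ^ 2 := by
    refine tsum_congr fun w => ?_
    rw [finsum_eq_single _ (wa + wb - w)]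
    · rw [MC.weightProj_of_mem (hmem w), if_pos rfl]
      rfl
    · intro s hs
      rw [MC.weightProj_of_mem (𝒴.scaled_mem_weight ha hb q s), if_neg, smul_zero]
      rintro rfl
      exact hs (by ring)
  have hsum : Summable fun w : ℂ => ‖f w‖ ^ 2 := by
    rw [hform] at h
    have h' : ∑' w : ℂ, ((‖f w‖₊ ^ 2 : ℝ≥0) : ℝ≥0∞) ≠ ∞ := by
      simpa [enorm] using h
    rw [ENNReal.tsum_coe_ne_top_iff_summable, ← NNReal.summable_coe] at h'
    simpa using h'
  have hO : OrthogonalFamily ℂ (fun w => Module.End.eigenspace (MC.L 0) w) fun w =>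
      (UniformSpace.Completion.toComplₗᵢ (𝕜 := ℂ) (E := C)).comp
        (Module.End.eigenspace (MC.L 0) w).subtypeₗᵢ := fun w w' hw x y => by
    simpa using hC.inner_weight hw x.2 y.2
  have h2 := (hO.summable_iff_norm_sq_summable f).2 hsum
  rw [← (Equiv.subLeft (wa + wb)).summable_iff] at h2
  refine h2.congr fun s => ?_
  simp [f, seriesTerm]

theorem seriesTerm_scaled_add_left (lg : ℂ → ℂ) (q : ℝ) (z : ℂ) (a a' : A) (b : B) :
    seriesTerm lg (𝒴.scaled q (a + a')) z b
      = seriesTerm lg (𝒴.scaled q a) z b + seriesTerm lg (𝒴.scaled q a') z b := by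
  ext s
  simp [seriesTerm, scaled_add_left, UniformSpace.Completion.coe_add]

theorem summable_scaled (hB : MB.IsUnitary U) (hC : MC.IsUnitary U) {lg : ℂ → ℂ} {q : ℝ} {z : ℂ}
    {S : Submodule ℂ A} (h : ∀ a ∈ S, ∀ b, 𝒴.form lg q z a b ≠ ∞) {a : A}
    (ha : a ∈ MA.homPart S) (b : B) : Summable (seriesTerm lg (𝒴.scaled q a) z b) := by
  refine VOAModule.induction_homPart
    (p := fun a => Summable (seriesTerm lg (𝒴.scaled q a) z b)) ?_
    (fun x y hx hy => by rw [seriesTerm_scaled_add_left]; exact hx.add hy)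
    (fun n α _ a ha => ?_) ha
  · refine summable_zero.congr fun s => ?_
    simp [seriesTerm, scaled_zero_left, UniformSpace.Completion.coe_zero]
  · refine hB.induction_refined (p := fun b => Summable (seriesTerm lg (𝒴.scaled q a) z b)) ?_
      (fun x y hx hy => by rw [seriesTerm_add]; exact hx.add hy) (fun k β _ b hb => ?_) b
    · refine summable_zero.congr fun s => ?_
      simp [seriesTerm, UniformSpace.Completion.coe_zero]
    · exact 𝒴.summable_scaled_of_weight hC ha.2.2 hb.2 (h a ha.1 b)

/-- The form bounds the squared norm of the sum of the series: its terms are the squared norms of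
the weight components of the sum. -/
theorem norm_seriesMap_scaled_le (hA : MA.IsUnitary U) (hB : MB.IsUnitary U) (hC : MC.IsUnitary U)
    {lg : ℂ → ℂ} {q : ℝ} {z : ℂ} {a : A}
    (hF : ∀ b, Summable (seriesTerm lg (𝒴.scaled q a) z b)) {b : B} {M : ℝ≥0}
    (h : 𝒴.form lg q z a b ≤ (M : ℝ≥0∞) ^ 2) : ‖seriesMap hF b‖ ≤ M := by
  let g : ℂ → C := fun w =>
    ∑ᶠ s : ℂ, Complex.exp (-s * lg z) • MC.weightProj w (𝒴.scaled q a s b)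
  refine norm_completion_le_of_inner_le (r := fun w => ‖g w‖)
    MC.weights_internal.submodule_iSup_eq_top hC.orthogonalFamily_weight M.2 (fun w c hc => ?_)
    fun F => ?_
  · obtain ⟨F, hF0⟩ := 𝒴.exists_finset_weightProj_scaled (MC := MC) hA hB q w a b
    have hg : g w = ∑ s ∈ F, Complex.exp (-s * lg z) • MC.weightProj w (𝒴.scaled q a s b) := by
      refine finsum_eq_sum_of_support_subset _ fun s hs => ?_
      contrapose! hs
      simp [hF0 s (by simpa using hs)]
    have h1 := hasSum_inner_seriesMap hF b c
    have h2 : HasSum (fun s => Complex.exp (-s * lg z) * ⟪c, 𝒴.scaled q a s b⟫_ℂ)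
        (∑ s ∈ F, Complex.exp (-s * lg z) * ⟪c, 𝒴.scaled q a s b⟫_ℂ) := by
      refine hasSum_sum_of_ne_finset_zero fun s hs => ?_
      rw [← VOAModule.inner_weightProj hC hc, hF0 s hs, inner_zero_right, mul_zero]
    have h3 : ⟪(c : UniformSpace.Completion C), seriesMap hF b⟫_ℂ = ⟪c, g w⟫_ℂ := by
      rw [h1.unique h2, hg, inner_sum]
      refine Finset.sum_congr rfl fun s _ => ?_
      rw [inner_smul_right, VOAModule.inner_weightProj hC hc]
    rw [h3, mul_comm]
    exact norm_inner_le_norm c (g w)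
  · have h1 : ∑ w ∈ F, ‖g w‖ₑ ^ 2 ≤ (M : ℝ≥0∞) ^ 2 := (ENNReal.sum_le_tsum F).trans h
    have h2 : ∑ w ∈ F, ‖g w‖₊ ^ 2 ≤ M ^ 2 := by
      simp only [enorm] at h1
      exact_mod_cast h1
    simpa using NNReal.coe_le_coe.2 h2

/-! ### The truncated scaled intertwiner and the estimate -/

theorem summable_scaledTruncated (hA : MA.IsUnitary U) (hB : MB.IsUnitary U) (hC : MC.IsUnitary U)
    {lg : ℂ → ℂ} {q : ℝ} {z : ℂ} {a : A} (hF : ∀ b, Summable (seriesTerm lg (𝒴.scaled q a) z b))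
    (N : ℝ) (b : B) : Summable (seriesTerm lg (𝒴.scaledTruncated N q a) z b) := by
  refine MB.induction_level
    (p := fun b => Summable (seriesTerm lg (𝒴.scaledTruncated N q a) z b)) ?_
    (fun x y hx hy => by rw [seriesTerm_add]; exact hx.add hy) (fun k b hb => ?_) b
  · refine summable_zero.congr fun s => ?_
    simp [seriesTerm, UniformSpace.Completion.coe_zero]
  · let P : ℤ → UniformSpace.Completion C →L[ℂ] UniformSpace.Completion C := fun l =>
      ((MC.levelProj l).mkContinuous 1 fun x => by
        simpa using VOAModule.norm_levelProj_le hC l x).completion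
    have h : Summable fun s => ∑ m ∈ Finset.Icc (-⌊N⌋) ⌊N⌋,
        P (k - m) (seriesTerm lg (𝒴.scaled q a) z b s) :=
      summable_sum fun m _ => (hF b).mapL (P (k - m))
    refine h.congr fun s => ?_
    have hcoe := map_sum (UniformSpace.Completion.toComplₗᵢ (𝕜 := ℂ) (E := C))
      (fun m => MC.levelProj (k - m) (Complex.exp (-s * lg z) • 𝒴.scaled q a s b))
      (Finset.Icc (-⌊N⌋) ⌊N⌋)
    simp only [UniformSpace.Completion.coe_toComplₗᵢ] at hcoe
    simp only [seriesTerm, P, ContinuousLinearMap.completion_apply_coe,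
      LinearMap.mkContinuous_apply]
    rw [𝒴.scaledTruncated_apply hA hB hC N q a s hb, ← hcoe, Finset.smul_sum]
    simp only [map_smul]

theorem inner_seriesMap_scaledTruncated (hA : MA.IsUnitary U) (hB : MB.IsUnitary U)
    (hC : MC.IsUnitary U) {lg : ℂ → ℂ} {q : ℝ} {z : ℂ} {a : A} {N : ℝ}
    (hF : ∀ b, Summable (seriesTerm lg (𝒴.scaled q a) z b))
    (hG : ∀ b, Summable (seriesTerm lg (𝒴.scaledTruncated N q a) z b))
    {k l : ℕ} {b : B} (hb : b ∈ MB.level k) {c : C} (hc : c ∈ MC.level l) :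
    ⟪(c : UniformSpace.Completion C), seriesMap hG b⟫_ℂ =
      if (k : ℤ) - l ∈ Finset.Icc (-⌊N⌋) ⌊N⌋ then
        ⟪(c : UniformSpace.Completion C), seriesMap hF b⟫_ℂ else 0 := by
  have hs : ∀ s, ⟪c, 𝒴.scaledTruncated N q a s b⟫_ℂ =
      if (k : ℤ) - l ∈ Finset.Icc (-⌊N⌋) ⌊N⌋ then ⟪c, 𝒴.scaled q a s b⟫_ℂ else 0 := by
    intro s
    rw [𝒴.scaledTruncated_apply hA hB hC N q a s hb, inner_sum]
    simp only [VOAModule.inner_levelProj hC hc]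
    rw [← Finset.sum_ite_eq' (Finset.Icc (-⌊N⌋) ⌊N⌋) ((k : ℤ) - l)
      fun _ => ⟪c, 𝒴.scaled q a s b⟫_ℂ]
    refine Finset.sum_congr rfl fun m _ => ?_
    exact if_congr (by omega) rfl rfl
  refine (hasSum_inner_seriesMap hG b c).unique ?_
  simp only [hs]
  split_ifs with h
  · exact hasSum_inner_seriesMap hF b c
  · simp

/-- Splitting `q = q₁ q₂` moves the factor `q₁ ^ (L₀ / 2)` to the outer vectors. -/
theorem inner_seriesMap_scaled_mul (hA : MA.IsUnitary U) (hB : MB.IsUnitary U)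
    (hC : MC.IsUnitary U) {lg : ℂ → ℂ} {q₁ q₂ : ℝ} (h₁ : 0 < q₁) (h₂ : 0 < q₂) {z : ℂ} {a : A}
    (hF : ∀ b, Summable (seriesTerm lg (𝒴.scaled (q₁ * q₂) a) z b))
    (hF₂ : ∀ b, Summable (seriesTerm lg (𝒴.scaled q₂ (MA.qHalfL0 q₁ a)) z b)) (b : B) (c : C) :
    ⟪(c : UniformSpace.Completion C), seriesMap hF b⟫_ℂ =
      ⟪((MC.qHalfL0 q₁ c : C) : UniformSpace.Completion C),
        seriesMap hF₂ (MB.qHalfL0 q₁ b)⟫_ℂ := by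
  refine (hasSum_inner_seriesMap hF b c).unique ?_
  simp only [𝒴.scaled_mul hA hB hC h₁.le h₂.le, ← VOAModule.inner_qHalfL0 hC h₁]
  exact hasSum_inner_seriesMap hF₂ (MB.qHalfL0 q₁ b) (MC.qHalfL0 q₁ c)

theorem rpow_half_sq {q : ℝ} (h : 0 < q) (x : ℝ) : (q ^ (x / 2)) ^ 2 = q ^ x := by
  rw [← Real.rpow_natCast, ← Real.rpow_mul h.le]
  norm_num

/-- The Hilbert–Schmidt estimate: the matrix entry of `W_q - W_q^{[N]}` between levels `k` and `l`
vanishes for `|k - l| ≤ N` and has norm at most `T q₁ ^ ((k + l) / 2)` otherwise. -/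
theorem norm_seriesMap_sub_le (hA : MA.IsUnitary U) (hB : MB.IsUnitary U) (hC : MC.IsUnitary U)
    {lg : ℂ → ℂ} {q₁ q₂ : ℝ} (h₁ : 0 < q₁) (h₁' : q₁ < 1) (h₂ : 0 < q₂) {z : ℂ} {a : A} {N : ℝ}
    (hF : ∀ b, Summable (seriesTerm lg (𝒴.scaled (q₁ * q₂) a) z b))
    (hG : ∀ b, Summable (seriesTerm lg (𝒴.scaledTruncated N (q₁ * q₂) a) z b))
    (hF₂ : ∀ b, Summable (seriesTerm lg (𝒴.scaled q₂ (MA.qHalfL0 q₁ a)) z b))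
    {T : ℝ} (hT : 0 ≤ T) (hbound : ∀ b, ‖seriesMap hF₂ b‖ ≤ T * ‖b‖) (b : B) :
    ‖seriesMap hF b - seriesMap hG b‖ ≤ T * 2 * (q₁ ^ (N / 2) * (1 / (1 - q₁))) * ‖b‖ := by
  have hq : 0 < 1 - q₁ := by linarith
  obtain ⟨K, -, hK⟩ := MB.exists_sum_levelProj b
  let far : ℕ → Finset ℕ := fun l =>
    K.filter fun k => (k : ℤ) - l ∉ Finset.Icc (-⌊N⌋) ⌊N⌋
  refine norm_completion_le_of_inner_le
    (r := fun l => T * q₁ ^ ((l : ℝ) / 2) * (√(∑ k ∈ far l, q₁ ^ k) * ‖b‖))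
    MC.level_internal.submodule_iSup_eq_top hC.orthogonalFamily_level (by positivity)
    (fun l c hc => ?_) fun L => ?_
  · have hexp : ⟪(c : UniformSpace.Completion C), seriesMap hF b - seriesMap hG b⟫_ℂ
        = ∑ k ∈ far l, ⟪(c : UniformSpace.Completion C), seriesMap hF (MB.levelProj k b)⟫_ℂ := by
      conv_lhs => rw [← hK]
      rw [map_sum, map_sum, ← Finset.sum_sub_distrib, inner_sum, Finset.sum_filter]
      refine Finset.sum_congr rfl fun k _ => ?_
      rw [inner_sub_right,
        𝒴.inner_seriesMap_scaledTruncated hA hB hC hF hG (MB.levelProj_mem k b) hc]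
      by_cases h : (k : ℤ) - l ∈ Finset.Icc (-⌊N⌋) ⌊N⌋ <;> simp [h]
    have hentry : ∀ k : ℕ,
        ‖⟪(c : UniformSpace.Completion C), seriesMap hF (MB.levelProj k b)⟫_ℂ‖
        ≤ T * q₁ ^ ((l : ℝ) / 2) * ‖c‖ * (q₁ ^ ((k : ℝ) / 2) * ‖MB.levelProj k b‖) := by
      intro k
      rw [𝒴.inner_seriesMap_scaled_mul hA hB hC h₁ h₂ hF hF₂]
      calc _ ≤ ‖MC.qHalfL0 q₁ c‖ * ‖seriesMap hF₂ (MB.qHalfL0 q₁ (MB.levelProj k b))‖ := by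
            rw [← UniformSpace.Completion.norm_coe (MC.qHalfL0 q₁ c)]
            exact norm_inner_le_norm _ _
        _ ≤ (q₁ ^ ((l : ℝ) / 2) * ‖c‖) * (T * (q₁ ^ ((k : ℝ) / 2) * ‖MB.levelProj k b‖)) := by
            gcongr
            · exact VOAModule.norm_qHalfL0_level_le hC h₁ h₁' hc
            · refine (hbound _).trans ?_
              gcongr
              exact VOAModule.norm_qHalfL0_level_le hB h₁ h₁' (MB.levelProj_mem k b)
        _ = _ := by ring
    rw [hexp]
    calc _ ≤ ∑ k ∈ far l, T * q₁ ^ ((l : ℝ) / 2) * ‖c‖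
            * (q₁ ^ ((k : ℝ) / 2) * ‖MB.levelProj k b‖) :=
          (norm_sum_le _ _).trans (Finset.sum_le_sum fun k _ => hentry k)
      _ = T * q₁ ^ ((l : ℝ) / 2) * ‖c‖
            * ∑ k ∈ far l, q₁ ^ ((k : ℝ) / 2) * ‖MB.levelProj k b‖ := by
          rw [Finset.mul_sum]
      _ ≤ T * q₁ ^ ((l : ℝ) / 2) * ‖c‖ * (√(∑ k ∈ far l, q₁ ^ k) * ‖b‖) := by
          gcongr
          refine (Real.sum_mul_le_sqrt_mul_sqrt _ _ _).trans ?_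
          simp only [rpow_half_sq h₁, Real.rpow_natCast]
          gcongr
          refine Real.sqrt_le_iff.2 ⟨norm_nonneg _, ?_⟩
          rw [← VOAModule.sum_norm_levelProj_sq hB K b hK]
          exact Finset.sum_le_sum_of_subset_of_nonneg (Finset.filter_subset _ _)
            fun _ _ _ => by positivity
      _ = _ := by ring
  · have hterm : ∀ l : ℕ, (T * q₁ ^ ((l : ℝ) / 2) * (√(∑ k ∈ far l, q₁ ^ k) * ‖b‖)) ^ 2
        = (T * ‖b‖) ^ 2 * ∑ k ∈ K, (if (k : ℤ) - l ∈ Finset.Icc (-⌊N⌋) ⌊N⌋ then 0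
            else q₁ ^ l * q₁ ^ k) := by
      intro l
      have h0 : 0 ≤ ∑ k ∈ far l, q₁ ^ k := Finset.sum_nonneg fun _ _ => by positivity
      have h1 : ∑ k ∈ K, (if (k : ℤ) - l ∈ Finset.Icc (-⌊N⌋) ⌊N⌋ then 0
            else q₁ ^ l * q₁ ^ k) = q₁ ^ l * ∑ k ∈ far l, q₁ ^ k := by
        rw [Finset.mul_sum, Finset.sum_filter]
        refine Finset.sum_congr rfl fun k _ => ?_
        rw [ite_not]
      rw [h1, mul_pow, mul_pow, mul_pow, rpow_half_sq h₁, Real.rpow_natCast, Real.sq_sqrt h0]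
      ring
    rw [Finset.sum_congr rfl fun l _ => hterm l, ← Finset.mul_sum]
    calc _ ≤ (T * ‖b‖) ^ 2 * (2 * (q₁ ^ N / (1 - q₁) ^ 2)) := by
          gcongr
          exact sum_geometric_offDiagonal_le h₁ h₁' N L K
      _ ≤ (T * ‖b‖) ^ 2 * (4 * (q₁ ^ N / (1 - q₁) ^ 2)) := by
          gcongr
          norm_num
      _ = _ := by
          rw [← rpow_half_sq h₁ N]
          field_simp
          ring

variable {𝒴}

theorem IsBoundednessParameter.exists_summable (hA : MA.IsUnitary U) (hB : MB.IsUnitary U)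
    (hC : MC.IsUnitary U) {lg : ℂ → ℂ} {S : Submodule ℂ A} {θ : ℝ → ℂ → ℝ≥0∞}
    (hθ : 𝒴.IsBoundednessParameter lg S θ) {z : ℂ} (hz : z ≠ 0) {q : ℝ} (h0 : 0 < q) (h1 : q < 1)
    (hfin : θ q z ≠ ∞) {a : A} (ha : a ∈ MA.homPart S) :
    ∃ hF : ∀ b, Summable (seriesTerm lg (𝒴.scaled q a) z b),
      ∀ b, ‖seriesMap hF b‖ ≤ (θ q z).toReal * ‖a‖ * ‖b‖ := by
  have hform := (hθ z hz q h0 h1).1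
  lift θ q z to ℝ≥0 using hfin with t
  refine ⟨𝒴.summable_scaled hB hC (S := S) (fun a ha b => ((hform a ha b).trans_lt ?_).ne) ha,
    fun b => ?_⟩
  · exact ENNReal.mul_lt_top (ENNReal.mul_lt_top (by simp) (by simp)) (by simp)
  · refine 𝒴.norm_seriesMap_scaled_le hA hB hC _ (M := t * ‖a‖₊ * ‖b‖₊) ?_
    refine (hform a (MA.homPart_le S ha) b).trans_eq ?_
    simp only [enorm]
    push_cast
    ring

/-- The estimate of `W_q - W_q^{[N]}` for a factorization `q = q₁ q₂` with `θ(q₂, z)` finite. -/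
theorem IsBoundednessParameter.norm_sub_le (hA : MA.IsUnitary U) (hB : MB.IsUnitary U)
    (hC : MC.IsUnitary U) {lg : ℂ → ℂ} {S : Submodule ℂ A} {θ : ℝ → ℂ → ℝ≥0∞}
    (hθ : 𝒴.IsBoundednessParameter lg S θ) {z : ℂ} (hz : z ≠ 0) {q q₁ q₂ : ℝ}
    (h₁ : 0 < q₁) (h₁' : q₁ < 1) (h₂ : 0 < q₂) (h₂' : q₂ < 1) (hq : q₁ * q₂ = q)
    (hfin : θ q₂ z ≠ ∞) {a : A} (ha : a ∈ MA.homPart S) {N : ℝ}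
    (hF : ∀ b, Summable (seriesTerm lg (𝒴.scaled q a) z b))
    (hG : ∀ b, Summable (seriesTerm lg (𝒴.scaledTruncated N q a) z b)) (b : B) :
    ‖seriesMap hF b - seriesMap hG b‖
      ≤ (θ q₂ z).toReal * ‖a‖ * 2 * (q₁ ^ (N / 2) * (1 / (1 - q₁))) * ‖b‖ := by
  subst hq
  obtain ⟨hF₂, hbound⟩ := hθ.exists_summable hA hB hC hz h₂ h₂' hfin
    (VOAModule.qHalfL0_mem_homPart q₁ ha)
  refine 𝒴.norm_seriesMap_sub_le hA hB hC h₁ h₁' h₂ hF hG hF₂ (by positivity) (fun b => ?_) b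
  refine (hbound b).trans ?_
  gcongr
  exact VOAModule.norm_qHalfL0_le hA h₁ h₁' a

end Intertwiner

end TruncatedIntertwiner

open TruncatedIntertwiner

theorem mainTheorem2
    {V A B C : Type*} [NormedAddCommGroup V] [InnerProductSpace ℂ V]
    [NormedAddCommGroup A] [InnerProductSpace ℂ A] [NormedAddCommGroup B] [InnerProductSpace ℂ B]
    [NormedAddCommGroup C] [InnerProductSpace ℂ C]
    (𝒱 : TruncatedIntertwiner.VOA V) (U : TruncatedIntertwiner.UnitaryStructure 𝒱)
    (MA : TruncatedIntertwiner.VOAModule 𝒱 A) (MB : TruncatedIntertwiner.VOAModule 𝒱 B)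
    (MC : TruncatedIntertwiner.VOAModule 𝒱 C)
    (hA : MA.IsUnitary U) (hB : MB.IsUnitary U) (hC : MC.IsUnitary U) :
    ∃ κ : ℝ≥0, 0 < κ ∧
      ∀ (𝒴 : TruncatedIntertwiner.Intertwiner MA MB MC) (S : Submodule ℂ A)
        (lg : ℂ → ℂ) (_ : ∀ z : ℂ, z ≠ 0 → Complex.exp (lg z) = z)
        (θ : ℝ → ℂ → ℝ≥0∞) (_ : 𝒴.IsBoundednessParameter lg S θ)
        (z : ℂ) (_ : z ≠ 0) (q : ℝ) (_ : 0 < q) (_ : q < min (‖z‖ ^ 2) (1 / ‖z‖ ^ 2))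
        (N : ℝ) (_ : 0 < N) (a : A) (_ : a ∈ MA.homPart S),
        ∃ W WN : UniformSpace.Completion B →L[ℂ] UniformSpace.Completion C,
          TruncatedIntertwiner.IsValueAt lg (𝒴.scaled q a) z W ∧
          TruncatedIntertwiner.IsValueAt lg (𝒴.scaledTruncated N q a) z WN ∧
          (∀ q₁ q₂ : ℝ, 0 < q₁ → q₁ < 1 → 0 < q₂ → q₂ < 1 → q₁ * q₂ = q →
            ‖W - WN‖ₑ ≤ ‖a‖ₑ * κ * θ q₂ z * ENNReal.ofReal (q₁ ^ (N / 2) * (1 / (1 - q₁)))) ∧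
          ‖W - WN‖ₑ ≤
            ‖a‖ₑ * κ * θ (√q) z * ENNReal.ofReal (q ^ (N / 4) * (1 / (1 - √q))) := by
  refine ⟨2, two_pos, ?_⟩
  intro 𝒴 S lg _ θ hθ z hz q hq0 hqz N _ a ha
  have hmin : min (‖z‖ ^ 2) (1 / ‖z‖ ^ 2) ≤ 1 := by
    rcases le_total (‖z‖ ^ 2) 1 with h | h
    · exact (min_le_left _ _).trans h
    · exact (min_le_right _ _).trans (div_le_one_of_le₀ h (by positivity))
  have hq1 : q < 1 := hqz.trans_le hmin
  -- At some `p` strictly above `q` the value `θ p z` is still finite, so the estimate for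
  -- `q = (q / p) * p` shows that the truncated operator is bounded.
  obtain ⟨p, hqp, hpz⟩ := exists_between hqz
  have hp0 : 0 < p := hq0.trans hqp
  have hp1 : p < 1 := hpz.trans_le hmin
  obtain ⟨hF, hFb⟩ := hθ.exists_summable hA hB hC hz hq0 hq1
    ((hθ z hz q hq0 hq1).2 hqz).ne ha
  have hG := 𝒴.summable_scaledTruncated hA hB hC hF N
  have hdiff := hθ.norm_sub_le hA hB hC hz (q₁ := q / p) (by positivity)
    ((div_lt_one hp0).2 hqp) hp0 hp1 (div_mul_cancel₀ q hp0.ne')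
    ((hθ z hz p hp0 hp1).2 hpz).ne ha hF hG
  obtain ⟨W, hW⟩ := exists_isValueAt hF hFb
  obtain ⟨WN, hWN⟩ := exists_isValueAt hG fun b => by
    have h := norm_sub_le (seriesMap hF b) (seriesMap hF b - seriesMap hG b)
    rw [sub_sub_cancel] at h
    exact (h.trans (add_le_add (hFb b) (hdiff b))).trans_eq (add_mul _ _ _).symm
  have main : ∀ q₁ q₂ : ℝ, 0 < q₁ → q₁ < 1 → 0 < q₂ → q₂ < 1 → q₁ * q₂ = q →
      ‖W - WN‖ₑ ≤ ‖a‖ₑ * (2 : ℝ≥0) * θ q₂ z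
        * ENNReal.ofReal (q₁ ^ (N / 2) * (1 / (1 - q₁))) := by
    intro q₁ q₂ h₁ h₁' h₂ h₂' hq
    have hsub : 0 < 1 - q₁ := by linarith
    have hpos : 0 < q₁ ^ (N / 2) * (1 / (1 - q₁)) := by positivity
    -- If `a = 0` and `θ q₂ z = ∞` the bound is `0`, so this case needs the finite value `θ p z`.
    by_cases ha0 : a = 0
    · subst ha0
      have h := norm_sub_le_of_isValueAt hF hG hW hWN le_rfl fun b => by simpa using hdiff b
      rw [← ofReal_norm, ENNReal.ofReal_eq_zero.2 h]
      exact bot_le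
    by_cases hfin : θ q₂ z = ∞
    · rw [hfin, ENNReal.mul_top (by simpa using ha0), ENNReal.top_mul (by simpa using hpos)]
      exact le_top
    · have h := norm_sub_le_of_isValueAt hF hG hW hWN (by positivity)
        (hθ.norm_sub_le hA hB hC hz h₁ h₁' h₂ h₂' hq hfin ha hF hG)
      rw [← ofReal_norm, ← ofReal_norm]
      refine (ENNReal.ofReal_le_ofReal h).trans_eq ?_
      rw [ENNReal.ofReal_mul (by positivity), ENNReal.ofReal_mul (by positivity),
        ENNReal.ofReal_mul (by positivity), ENNReal.ofReal_toReal hfin]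
      congr 1
      simp only [ENNReal.ofReal_ofNat, ENNReal.coe_ofNat]
      ring
  refine ⟨W, WN, hW, hWN, main, ?_⟩
  have hs0 : 0 < √q := Real.sqrt_pos.2 hq0
  have hs1 : √q < 1 := by
    rw [Real.sqrt_lt' one_pos]
    simpa using hq1
  have h := main (√q) (√q) hs0 hs1 hs0 hs1 (Real.mul_self_sqrt hq0.le)
  have hpow : √q ^ (N / 2) = q ^ (N / 4) := by
    rw [Real.sqrt_eq_rpow, ← Real.rpow_mul hq0.le]
    congr 1
    ring
  rwa [hpow] at h
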